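/- **Market.** Let $N\neq\emptyset$ and $M$ be finite sets of agents and items, $m=|M|$. Agent $i$ has the utility $u_i(x)=\sum_j u_{ij}(x_j)$, where $u_{ij}:\mathbb R_+\to\mathbb R$ is continuous with $u_{ij}(0)=0$, piecewise linear, concave and monotone, with segments $k=1,\dots,|u_{ij}|$ of strictly decreasing slopes $U_{ijk}$ (all $\ge 0$ or all $\le 0$) and lengths $L_{ijk}>0$. The last segment is infinite; its $L_{ijk}$ is a constant $>1$ used in its place in the complementarity problem below. Agent $i$ brings $W_{ij}\ge 0$ of item $j$, and $\sum_i W_{ij}=1$ for all $j$. Item $j$ is a good ($j\in M^+$) if $U_{ij1}>0$ for some $i$; otherwise it is a bad ($j\in M^-$), and then $D_{ijk}:=-U_{ijk}>0$ for all $i,k$. For every good, $\sum_{i}\sum_{k:U_{ijk}>0}L_{ijk}>1$. Given prices $\pi\in\mathbb R^M$, an allocation $(x_{ij})$ is a *competitive equilibrium* if every $x_i\ge 0$ maximizes $u_i$ over $\{y\ge 0:\sum_j y_j\pi_j=\sum_j W_{ij}\pi_j\}$ and $\sum_i x_{ij}=\sum_i W_{ij}$ for all $j$. **Strong connectivity.**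 Every agent brings a positive amount of some good and of some bad, and the directed graph on $N$ with an edge $i\to i'$ whenever, for some good $j$, the last slope of $u_{ij}$ is positive and $W_{i'j}>0$, is strongly connected. **No polynomial relation.** Every polynomial with rational coefficients that vanishes at $(U,W,L)$ vanishes at all real $(U',W',L')$ with $\sum_iW'_{ij}=1$ for all $j$, with $U'_{ijk}=0$ wherever $U_{ijk}=0$, with $W'_{ij}=0$ wherever $W_{ij}=0$, and with the same lengths of the last segments; moreover the graph on $N$ that joins two agents who bring a common item is connected (automatic if no $W_{ij}$ is $0$). **Complementarity problem.** For $P,R>0$, $\epsilon\in(0,1/m)^M$ and $\delta_j=1+\epsilon_j$, consider in the variables $y=(r,p,f,s)\ge 0$, $z\ge0$ $$\begin{aligned} &\textstyle\sum_{j\in M^+}W_{ij}p_j-\sum_{j\in M^-}W_{ij}p_j+\sum_{k,j\in M^+}f_{ijk}-\sum_{k,j\in M^-}f_{ijk}-z\le P\bigl(\sum_{j\in M^+}W_{ij}-\sum_{j\in M^-}W_{ij}\bigr)&&\perp r_i\\ &\textstyle\sum_{i,k}f_{ijk}+p_j\le P\quad(j\in M^-),\qquad -\sum_{i,k}f_{ijk}-p_j-\delta_jz\le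 -P\quad(j\in M^+)&&\perp p_j\\ &D_{ijk}r_i-p_j-s_{ijk}\le D_{ijk}R-P\quad(j\in M^-),\qquad -U_{ijk}r_i+p_j-s_{ijk}-z\le P-U_{ijk}R\quad(j\in M^+)&&\perp f_{ijk}\\ &f_{ijk}+L_{ijk}p_j\le L_{ijk}P&&\perp s_{ijk} \end{aligned}$$ Let $\mathcal P$ be the polyhedron of all linear inequalities (including $y,z\ge 0$), and let $v_a\ge 0$ be the slack of the constraint paired with $y_a$; solutions are the points of $\mathcal P$ with $y_av_a=0$ for all $a$. A *double label* is an $a$ with $y_a=v_a=0$. A *ray* is an unbounded edge of $\mathcal P$ that starts at a vertex with $z>0$ and consists of solutions. The primary ray is the set of solutions with $y=0$; every other ray is *secondary*. **Lemke's algorithm.** Start at the point $y=0$, $z=\max_{j\in M^+,i,k}U_{ijk}R-P$ of the primary ray. While $z>0$: take a double label $a$; if $v_a$ just became $0$ (it was positive on the edge along which the vertex was reached, which is the primary ray at the start), relax $y_a=0$, otherwise relax $v_a=0$; keep all other tight constraints tight and travel along the resulting edge to the next vertex. **Theorem.** Assume that the market is strongly connected and that $U,W,L$ have no polynomial relation.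 Then for every $P>0$, for all sufficiently large $R$ (depending on the market and on $P$), and for almost every $\epsilon\in(0,1/m)^{M}$, the following holds. As long as $z>0$ there is exactly one double label, the edge to be followed is bounded, and the next vertex is unique. After finitely many pivots the algorithm stops at a vertex solution with $z=0$, and the prices $P-p_j$ ($j\in M^+$), $-(P-p_j)$ ($j\in M^-$) with the allocation $x_{ij}=\sum_kf_{ijk}/(P-p_j)$ at that vertex form a competitive equilibrium. Everywhere on the path, edges and final point included, $p_j<P$ for all $j$ and $r_i<R$ for all $i$, and no point of the path lies on a secondary ray. -/

import Mathlib

open MeasureTheory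

/-! # Linear complementarity problems and Lemke's scheme -/

/-- An augmented linear complementarity problem `A y - c z ≤ q  ⟂  y ≥ 0`, `z ≥ 0`. -/
structure AugLCP (ι : Type*) where
  A : (ι → ℝ) →ₗ[ℝ] (ι → ℝ)
  q : ι → ℝ
  c : ι → ℝ

namespace AugLCP

variable {ι : Type*}

/-- The slack vector `v = q - A y + c z` at the point `x = (y, z)`. -/
def slack (Q : AugLCP ι) (x : (ι → ℝ) × ℝ) (a : ι) : ℝ :=
  Q.q a - Q.A x.1 a + Q.c a * x.2

/-- The polyhedron `y ≥ 0`, `v ≥ 0`, `z ≥ 0`. -/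
def polyhedron (Q : AugLCP ι) : Set ((ι → ℝ) × ℝ) :=
  {x | (∀ a, 0 ≤ x.1 a) ∧ (∀ a, 0 ≤ Q.slack x a) ∧ 0 ≤ x.2}

/-- The solutions of the augmented problem: points of the polyhedron with `y ⬝ v = 0`. -/
def solutions (Q : AugLCP ι) : Set ((ι → ℝ) × ℝ) :=
  {x | x ∈ Q.polyhedron ∧ ∀ a, x.1 a * Q.slack x a = 0}

/-- The vertices of the polyhedron. -/
def vertices (Q : AugLCP ι) : Set ((ι → ℝ) × ℝ) :=
  Set.extremePoints ℝ Q.polyhedron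

/-- `k` is a double label at `x`: both `y_k = 0` and `v_k = 0`. -/
def IsDoubleLabel (Q : AugLCP ι) (x : (ι → ℝ) × ℝ) (k : ι) : Prop :=
  x.1 k = 0 ∧ Q.slack x k = 0

/-- The quantity that the constraint `κ` requires to be nonnegative: `y_k` for `Sum.inl k`, and
`v_k` for `Sum.inr k`. -/
def constraintValue (Q : AugLCP ι) (x : (ι → ℝ) × ℝ) : ι ⊕ ι → ℝ
  | Sum.inl k => x.1 k
  | Sum.inr k => Q.slack x k

/-- The face of the polyhedron along which one travels from `x` when the constraint `κ` is
relaxed: every other constraint that is tight at `x` is kept tight. -/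
def pivotEdge (Q : AugLCP ι) (x : (ι → ℝ) × ℝ) (κ : ι ⊕ ι) : Set ((ι → ℝ) × ℝ) :=
  {x' | x' ∈ Q.polyhedron ∧
    ∀ κ', κ' ≠ κ → Q.constraintValue x κ' = 0 → Q.constraintValue x' κ' = 0}

open Classical in
/-- The pivoting rule at the double label `k`, when `prev` is a point of the edge along which the
current vertex was reached, other than that vertex. If `v_k` just became `0` (it was
positive at `prev`) then `y_k = 0` is relaxed, otherwise `v_k = 0` is relaxed. -/
noncomputable def relaxed (Q : AugLCP ι) (prev : (ι → ℝ) × ℝ) (k : ι) : ι ⊕ ι :=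
  if 0 < Q.slack prev k then Sum.inl k else Sum.inr k

/-- One pass through the loop of Lemke's algorithm: at the vertex `x`, reached along an edge
coming from `prev`, pivot at a double label and travel to the next vertex `next`. -/
def Step (Q : AugLCP ι) (prev x next : (ι → ℝ) × ℝ) : Prop :=
  ∃ k, Q.IsDoubleLabel x k ∧ next ≠ x ∧ next ∈ Q.vertices ∧
    next ∈ Q.pivotEdge x (Q.relaxed prev k)

/-- The point preceding `S t`; for `t = 0` it is a point of the ray `y = 0` beyond `S 0`. -/
def previous (S : ℕ → (ι → ℝ) × ℝ) : ℕ → (ι → ℝ) × ℝ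
  | 0 => (0, (S 0).2 + 1)
  | t + 1 => S t

/-- `S 0, …, S T` are the vertices visited in the first `T` passes through the loop
`while z > 0` of Lemke's algorithm, started at the point `(0, z₀)` of the primary ray. -/
def IsRun (Q : AugLCP ι) (z₀ : ℝ) (S : ℕ → (ι → ℝ) × ℝ) (T : ℕ) : Prop :=
  S 0 = (0, z₀) ∧ ∀ t < T, 0 < (S t).2 ∧ Q.Step (previous S t) (S t) (S (t + 1))

/-- A ray: an unbounded edge of the polyhedron that starts at a vertex with `z > 0`
and all of whose points are solutions. -/
def IsRay (Q : AugLCP ι) (E : Set ((ι → ℝ) × ℝ)) : Prop :=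
  ∃ x ∈ Q.vertices, 0 < x.2 ∧ ∃ d : (ι → ℝ) × ℝ, d ≠ 0 ∧
    E = {x' | ∃ α : ℝ, 0 ≤ α ∧ x' = x + α • d} ∧ IsExtreme ℝ Q.polyhedron E ∧ E ⊆ Q.solutions

/-- The primary ray: the solutions with `y = 0`. -/
def primaryRay (Q : AugLCP ι) : Set ((ι → ℝ) × ℝ) :=
  {x | x ∈ Q.solutions ∧ x.1 = 0}

/-- Every ray other than the primary one is secondary. -/
def IsSecondaryRay (Q : AugLCP ι) (E : Set ((ι → ℝ) × ℝ)) : Prop :=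
  Q.IsRay E ∧ E ≠ Q.primaryRay

end AugLCP

/-! # Exchange markets of mixed manna with SPLC utilities -/

/-- The data of a market with agents `N` and items `M`. The utility of agent `i` for item `j` is
piecewise linear with the segments `k : Fin (K i j + 1)`, of slope `U i j k` and length `L i j k`;
`W i j` is the amount of item `j` that agent `i` brings. The last segment is really of infinite
length (see `fill`); its `L i j k` is the finite length used instead of it in the
complementarity problem. -/
structure Market (N M : Type*) where
  K : N → M → ℕ
  U : (i : N) → (j : M) → Fin (K i j + 1) → ℝ
  L : (i : N) → (j : M) → Fin (K i j + 1) → ℝ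
  W : N → M → ℝ

namespace Market

variable {N M : Type*}

/-- An item is a good if some agent has positive utility for it, and a bad otherwise. -/
def IsGood (I : Market N M) (j : M) : Prop := ∃ i, 0 < I.U i j 0

open Classical in
/-- `1` for goods and `-1` for bads. -/
noncomputable def sgn (I : Market N M) (j : M) : ℝ := if I.IsGood j then 1 else -1

/-- The standing conventions. -/
structure IsSPLC [Fintype N] (I : Market N M) : Prop where
  /-- Concavity: slopes strictly decrease from segment to segment. -/
  slope_strictAnti : ∀ i j, StrictAnti (I.U i j)
  /-- Each `u_ij` is monotone. -/
  slope_sign : ∀ i j, (∀ k, 0 ≤ I.U i j k) ∨ (∀ k, I.U i j k ≤ 0)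
  length_pos : ∀ i j k, 0 < I.L i j k
  one_lt_length_last : ∀ i j, 1 < I.L i j (Fin.last _)
  endowment_nonneg : ∀ i j, 0 ≤ I.W i j
  /-- There is one unit of each item. -/
  supply : ∀ j, ∑ i, I.W i j = 1
  /-- A bad gives every agent a positive disutility. -/
  bad_neg : ∀ j, ¬ I.IsGood j → ∀ i, I.U i j 0 < 0
  /-- The desire for every good exceeds its supply. -/
  desire : ∀ j, I.IsGood j → 1 < ∑ i, ∑ k with 0 < I.U i j k, I.L i j k

/-- The amount of item `j` on its `k`-th segment, if agent `i` has the amount `t` of `j`;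
segments are filled in order, and the last one is infinite. -/
noncomputable def fill (I : Market N M) (i : N) (j : M) (k : Fin (I.K i j + 1)) (t : ℝ) : ℝ :=
  if k = Fin.last _ then max 0 (t - ∑ l ∈ Finset.Iio k, I.L i j l)
  else min (I.L i j k) (max 0 (t - ∑ l ∈ Finset.Iio k, I.L i j l))

/-- The additively separable utility function of agent `i`. -/
noncomputable def utility [Fintype M] (I : Market N M) (i : N) (x : M → ℝ) : ℝ :=
  ∑ j, ∑ k, I.U i j k * I.fill i j k (x j)

/-- Competitive equilibrium: every agent gets an optimal bundle among those that cost exactly what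
her endowment is worth, and demand meets supply. -/
def IsCompetitiveEquilibrium [Fintype N] [Fintype M] (I : Market N M)
    (price : M → ℝ) (x : N → M → ℝ) : Prop :=
  (∀ i, (∀ j, 0 ≤ x i j) ∧ ∑ j, x i j * price j = ∑ j, I.W i j * price j ∧
    ∀ y : M → ℝ, (∀ j, 0 ≤ y j) → ∑ j, y j * price j = ∑ j, I.W i j * price j →
      I.utility i y ≤ I.utility i (x i)) ∧
  ∀ j, ∑ i, x i j = ∑ i, I.W i j

/-- Agent `i` is non-satiated for the good `j`: the last slope is positive. -/
def NonSatiated (I : Market N M) (i : N) (j : M) : Prop := 0 < I.U i j (Fin.last _)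

/-- The economy graph has an edge from `i` to `i'` if `i` is non-satiated for some good that `i'`
brings. -/
def EconomyEdge (I : Market N M) (i i' : N) : Prop :=
  ∃ j, I.IsGood j ∧ I.NonSatiated i j ∧ 0 < I.W i' j

/-- Strong connectivity of the instance. -/
structure StronglyConnected (I : Market N M) : Prop where
  brings_good : ∀ i, ∃ j, I.IsGood j ∧ 0 < I.W i j
  brings_bad : ∀ i, ∃ j, ¬ I.IsGood j ∧ 0 < I.W i j
  economy : ∀ i i', Relation.ReflTransGen I.EconomyEdge i i'

/-! ## Absence of polynomial relations -/

/-- Indices of the input parameters. -/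
inductive Param (I : Market N M) : Type _
  | U (i : N) (j : M) (k : Fin (I.K i j + 1))
  | W (i : N) (j : M)
  | L (i : N) (j : M) (k : Fin (I.K i j + 1))

/-- The values of the input parameters. -/
def paramValue (I : Market N M) : I.Param → ℝ
  | .U i j k => I.U i j k
  | .W i j => I.W i j
  | .L i j k => I.L i j k

/-- Values of the parameters that satisfy the relations that hold by convention: one unit of each
item is supplied, the slopes and endowments that vanish are absent from the data, and the
lengths that stand for infinite ones are constants. -/
structure IsVariation [Fintype N] (I : Market N M) (θ : I.Param → ℝ) : Prop where
  supply : ∀ j, ∑ i, θ (.W i j) = 1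
  slope_zero : ∀ i j k, I.U i j k = 0 → θ (.U i j k) = 0
  endowment_zero : ∀ i j, I.W i j = 0 → θ (.W i j) = 0
  length_last : ∀ i j, θ (.L i j (Fin.last _)) = I.L i j (Fin.last _)

/-- The parameters `U`, `W`, `L` have no polynomial relation. -/
structure NoPolynomialRelation [Fintype N] (I : Market N M) : Prop where
  /-- A polynomial with rational coefficients that vanishes at the parameters vanishes
  identically, that is, at all values that satisfy the relations holding by convention. -/
  generic : ∀ F : MvPolynomial I.Param ℚ, MvPolynomial.aeval I.paramValue F = 0 →
    ∀ θ, I.IsVariation θ → MvPolynomial.aeval θ F = 0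
  /-- Vanishing endowments do not split the agents into groups that own no item in common: the
  supply conventions would then be relations between the total endowments of such groups.
  This holds automatically if no `W i j` vanishes. -/
  coowned : ∀ i i', Relation.ReflTransGen (fun a b => ∃ j, 0 < I.W a j ∧ 0 < I.W b j) i i'

/-! ## The augmented complementarity problem of a market -/

/-- The variables `r_i`, `p_j`, `f_ijk`, `s_ijk`. Each constraint is labelled by the variable
that is complementary to it. -/
inductive Var (I : Market N M) : Type _
  | r (i : N)
  | p (j : M)
  | f (i : N) (j : M) (k : Fin (I.K i j + 1))
  | s (i : N) (j : M) (k : Fin (I.K i j + 1))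

/-- The left-hand sides of the constraints, without the terms in `z`:
* `r i`: `∑_{good j} W_ij p_j - ∑_{bad j} W_ij p_j + ∑_{good j, k} f_ijk - ∑_{bad j, k} f_ijk`;
* `p j`: `∑_{i, k} f_ijk + p_j` for a bad `j`, and `-∑_{i, k} f_ijk - p_j` for a good `j`;
* `f i j k`: `D_ijk r_i - p_j - s_ijk` with `D_ijk = -U_ijk` for a bad `j`, and
  `-U_ijk r_i + p_j - s_ijk` for a good `j`;
* `s i j k`: `f_ijk + L_ijk p_j`. -/
noncomputable def lhs [Fintype N] [Fintype M] (I : Market N M) :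
    (I.Var → ℝ) →ₗ[ℝ] (I.Var → ℝ) where
  toFun y
    | .r i => ∑ j, I.sgn j * (I.W i j * y (.p j) + ∑ k, y (.f i j k))
    | .p j => -I.sgn j * (∑ i, ∑ k, y (.f i j k) + y (.p j))
    | .f i j k => -I.U i j k * y (.r i) + I.sgn j * y (.p j) - y (.s i j k)
    | .s i j k => y (.f i j k) + I.L i j k * y (.p j)
  map_add' y y' := by
    funext a
    cases a with
    | r i =>
      simp only [Pi.add_apply]
      rw [← Finset.sum_add_distrib]
      refine Finset.sum_congr rfl fun j _ => ?_
      rw [Finset.sum_add_distrib]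
      ring
    | p j => simp only [Pi.add_apply, Finset.sum_add_distrib]; ring
    | f i j k => simp only [Pi.add_apply]; ring
    | s i j k => simp only [Pi.add_apply]; ring
  map_smul' a y := by
    funext b
    cases b with
    | r i =>
      simp only [Pi.smul_apply, smul_eq_mul, RingHom.id_apply, ← Finset.mul_sum]
      rw [Finset.mul_sum]
      refine Finset.sum_congr rfl fun j _ => ?_
      ring
    | p j => simp only [Pi.smul_apply, smul_eq_mul, RingHom.id_apply, ← Finset.mul_sum]; ring
    | f i j k => simp only [Pi.smul_apply, smul_eq_mul, RingHom.id_apply]; ring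
    | s i j k => simp only [Pi.smul_apply, smul_eq_mul, RingHom.id_apply]; ring

open Classical in
/-- The augmented complementarity problem with the constants `P`, `R` and `δ_j = 1 + ε_j`. -/
noncomputable def lcp [Fintype N] [Fintype M] (I : Market N M) (P R : ℝ) (ε : M → ℝ) :
    AugLCP I.Var where
  A := I.lhs
  q
    | .r i => P * ∑ j, I.sgn j * I.W i j
    | .p j => -I.sgn j * P
    | .f i j k => I.sgn j * P - I.U i j k * R
    | .s i j k => I.L i j k * P
  c
    | .r _ => 1
    | .p j => if I.IsGood j then 1 + ε j else 0
    | .f _ j _ => if I.IsGood j then 1 else 0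
    | .s _ _ _ => 0

/-- The initial value `max_{good j, i, k} U_ijk R - P` of `z`. -/
noncomputable def startZ (I : Market N M) (P R : ℝ) : ℝ :=
  sSup {u | ∃ i j k, I.IsGood j ∧ u = I.U i j k} * R - P

/-- The prices at a solution: `P - p_j` for a good and `-(P - p_j)` for a bad. -/
noncomputable def price (I : Market N M) (P : ℝ) (y : I.Var → ℝ) (j : M) : ℝ :=
  I.sgn j * (P - y (.p j))

/-- The allocation at a solution: spending (or earning, for a bad) divided by `P - p_j`. -/
noncomputable def allocation (I : Market N M) (P : ℝ) (y : I.Var → ℝ) (i : N) (j : M) : ℝ :=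
  (∑ k, y (.f i j k)) / (P - y (.p j))

end Market

/-! Write `π_j = P - p_j` for the absolute prices and `λ_i = R - r_i` for the inverse bang per buck
of the agents. At a solution with `z = 0` and all `π_j`, `λ_i` positive, the complementarity
conditions say that markets clear and that every bundle is optimal. So it is enough that Lemke's
path reaches `z = 0` without leaving the region `π > 0`, `λ > 0` (`Market.region`).

The path (`AugLCP.Regular.exists_run`). Suppose that in a region all solutions with `z > 0` have at
most one double label, that segments of solutions do not leave it while `z > 0`, and that its only
half-lines of solutions are primary. Then each vertex of the path has exactly two edges, one per
constraint of its double label, so the path cannot return to a vertex. Vertices are determined by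
their tight constraints, hence are finite in number, and the path must end with `z = 0`.

The boundary (`Market.mem_region_of_tight`). If an edge ran into the boundary, some `λ_i` would
vanish there. An agent with `λ_i = 0` forces `z = 0` and zero prices for all bads and for the goods
that she brings; a zero price of a good makes `λ` vanish for all agents non-satiated for it. Strong
connectivity spreads this to all agents and items. Then all `r_i` and `p_j` are positive inside the
edge, all budget and market constraints are tight there, and their sum (Walras's law) gives `z = 0`
already inside the edge.

Nondegeneracy (`Market.nondegenerate`). Two double labels mean two tight constraints more than there
are variables, hence a linear relation between tight rows even when the column of `z` is dropped. If
a market row of a good takes part, the coefficient of `z` is a nonconstant affine function of `ε`,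
nonzero for almost every `ε`, which contradicts `z > 0`. Otherwise `ε` is absent, and the rows have
maximal rank among all variations of the data, because there is no polynomial relation and `R / P`
is large. Maximal rank forces the relation to hold to first order along each variation
(`sum_smul_derivative_mem_ker`); varying `U`, `L` and `W` removes its coefficients one kind after
the other. -/

set_option linter.unusedSectionVars false

/-! # Lemke's scheme for a regular problem -/

namespace AugLCP

variable {ι : Type*}

/-- The linear part of `constraintValue`. -/
def constraintDir (Q : AugLCP ι) : ι ⊕ ι → ((ι → ℝ) × ℝ) →ₗ[ℝ] ℝ
  | Sum.inl k => LinearMap.proj k ∘ₗ LinearMap.fst ℝ _ _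
  | Sum.inr k => -(LinearMap.proj k ∘ₗ Q.A ∘ₗ LinearMap.fst ℝ _ _) + Q.c k • LinearMap.snd ℝ _ _

theorem constraintValue_add_smul (Q : AugLCP ι) (x d : (ι → ℝ) × ℝ) (α : ℝ) (κ : ι ⊕ ι) :
    Q.constraintValue (x + α • d) κ = Q.constraintValue x κ + α * Q.constraintDir κ d := by
  cases κ with
  | inl k => simp [constraintValue, constraintDir]
  | inr k => simp [constraintValue, constraintDir, slack]; ring

theorem constraintValue_sub (Q : AugLCP ι) (x y : (ι → ℝ) × ℝ) (κ : ι ⊕ ι) :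
    Q.constraintValue x κ - Q.constraintValue y κ = Q.constraintDir κ (x - y) := by
  have h := Q.constraintValue_add_smul y (x - y) 1 κ
  rw [one_smul, add_sub_cancel] at h
  linarith

theorem constraintValue_combo (Q : AugLCP ι) (x y : (ι → ℝ) × ℝ) {a b : ℝ} (hab : a + b = 1)
    (κ : ι ⊕ ι) : Q.constraintValue (a • x + b • y) κ =
      a * Q.constraintValue x κ + b * Q.constraintValue y κ := by
  obtain rfl : a = 1 - b := by linarith
  have h : (1 - b) • x + b • y = x + b • (y - x) := by module
  rw [h, constraintValue_add_smul, ← constraintValue_sub]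
  ring

theorem mem_polyhedron_iff (Q : AugLCP ι) (x : (ι → ℝ) × ℝ) :
    x ∈ Q.polyhedron ↔ (∀ κ, 0 ≤ Q.constraintValue x κ) ∧ 0 ≤ x.2 := by
  constructor
  · rintro ⟨h1, h2, h3⟩
    exact ⟨fun κ => by cases κ; exacts [h1 _, h2 _], h3⟩
  · rintro ⟨h, h3⟩
    exact ⟨fun a => h (Sum.inl a), fun a => h (Sum.inr a), h3⟩

theorem mem_solutions_iff (Q : AugLCP ι) (x : (ι → ℝ) × ℝ) :
    x ∈ Q.solutions ↔ x ∈ Q.polyhedron ∧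
      ∀ κ, Q.constraintValue x κ = 0 ∨ Q.constraintValue x κ.swap = 0 := by
  refine and_congr_right fun _ => ⟨fun h κ => ?_, fun h a => ?_⟩
  · cases κ with
    | inl k => exact mul_eq_zero.1 (h k)
    | inr k => exact (mul_eq_zero.1 (h k)).symm
  · exact mul_eq_zero.2 (h (Sum.inl a))

theorem convex_polyhedron (Q : AugLCP ι) : Convex ℝ Q.polyhedron := by
  intro x hx y hy a b ha hb hab
  rw [mem_polyhedron_iff] at *
  refine ⟨fun κ => ?_, ?_⟩
  · rw [Q.constraintValue_combo x y hab]
    have := hx.1 κ; have := hy.1 κ; positivity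
  · have := hx.2; have := hy.2
    simp only [Prod.snd_add, Prod.smul_snd, smul_eq_mul]; positivity

/-- Tight constraints at an inner point of a segment are tight at its ends. -/
theorem constraintValue_eq_zero_of_openSegment (Q : AugLCP ι) {x u v : (ι → ℝ) × ℝ}
    (hu : u ∈ Q.polyhedron) (hv : v ∈ Q.polyhedron) (hx : x ∈ openSegment ℝ u v) {κ : ι ⊕ ι}
    (h : Q.constraintValue x κ = 0) : Q.constraintValue u κ = 0 ∧ Q.constraintValue v κ = 0 := by
  obtain ⟨a, b, ha, hb, hab, rfl⟩ := hx
  rw [Q.constraintValue_combo u v hab] at h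
  rw [mem_polyhedron_iff] at hu hv
  have h1 := mul_nonneg ha.le (hu.1 κ)
  have h2 := mul_nonneg hb.le (hv.1 κ)
  have h3 : a * Q.constraintValue u κ = 0 := by linarith
  have h4 : b * Q.constraintValue v κ = 0 := by linarith
  exact ⟨(mul_eq_zero.1 h3).resolve_left ha.ne', (mul_eq_zero.1 h4).resolve_left hb.ne'⟩

/-- Constraints that are not tight leave room for a short move, so only the tight ones matter to
first order. The condition `z ≥ 0` is not indexed by `κ`; `hz` takes care of it. -/
theorem eventually_mem_polyhedron [Finite ι] (Q : AugLCP ι) {x d : (ι → ℝ) × ℝ}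
    (hx : x ∈ Q.polyhedron) (hz : 0 < x.2)
    (hd : ∀ κ, Q.constraintValue x κ = 0 → 0 ≤ Q.constraintDir κ d) :
    ∀ᶠ t : ℝ in nhdsWithin 0 (Set.Ioi 0), x + t • d ∈ Q.polyhedron := by
  have hlin : ∀ a b : ℝ, 0 < a → ∀ᶠ t : ℝ in nhdsWithin 0 (Set.Ioi 0), 0 ≤ a + t * b := by
    intro a b ha
    have hc : Filter.Tendsto (fun t : ℝ => a + t * b) (nhds 0) (nhds a) := by
      have : Continuous fun t : ℝ => a + t * b := by fun_prop
      simpa using this.tendsto 0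
    exact (hc.mono_left nhdsWithin_le_nhds).eventually (eventually_ge_nhds ha)
  have h1 : ∀ᶠ t : ℝ in nhdsWithin 0 (Set.Ioi 0), ∀ κ, 0 ≤ Q.constraintValue (x + t • d) κ := by
    rw [Filter.eventually_all]
    intro κ
    simp only [constraintValue_add_smul]
    rcases (((Q.mem_polyhedron_iff x).1 hx).1 κ).eq_or_lt with h | h
    · filter_upwards [self_mem_nhdsWithin] with t ht
      rw [← h, zero_add]
      exact mul_nonneg (le_of_lt ht) (hd κ h.symm)
    · exact hlin _ _ h
  filter_upwards [h1, hlin x.2 d.2 hz] with t ht1 ht2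
  exact (Q.mem_polyhedron_iff _).2 ⟨ht1, by simpa using ht2⟩

/-- Otherwise short moves along `d` and `-d` would both be feasible, with `x` as their midpoint.
Thus the tight constraints at a vertex with `z > 0` have full rank. -/
theorem eq_zero_of_mem_vertices [Finite ι] (Q : AugLCP ι) {x d : (ι → ℝ) × ℝ}
    (hx : x ∈ Q.vertices) (hz : 0 < x.2)
    (hd : ∀ κ, Q.constraintValue x κ = 0 → Q.constraintDir κ d = 0) : d = 0 := by
  have h1 := Q.eventually_mem_polyhedron hx.1 hz (fun κ h => (hd κ h).ge)
  have h2 := Q.eventually_mem_polyhedron (d := -d) hx.1 hz (fun κ h => by simp [hd κ h])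
  obtain ⟨t, ⟨ht1, ht2⟩, ht⟩ := ((h1.and h2).and self_mem_nhdsWithin).exists
  have ht : (0 : ℝ) < t := ht
  have hmem : x ∈ openSegment ℝ (x + t • d) (x + t • -d) :=
    ⟨1 / 2, 1 / 2, by norm_num, by norm_num, by norm_num, by module⟩
  have h3 := hx.2 ht1 ht2 hmem
  have h4 : t • d = 0 := by simpa using h3
  exact (smul_eq_zero.1 h4).resolve_left ht.ne'

theorem eq_of_tight_imp_tight [Finite ι] (Q : AugLCP ι) {x y : (ι → ℝ) × ℝ}
    (hx : x ∈ Q.vertices) (hz : 0 < x.2)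
    (h : ∀ κ, Q.constraintValue x κ = 0 → Q.constraintValue y κ = 0) : y = x := by
  refine sub_eq_zero.1 (Q.eq_zero_of_mem_vertices hx hz fun κ hκ => ?_)
  rw [← constraintValue_sub, h κ hκ, hκ, sub_zero]

/-- The label of a constraint. -/
def label : ι ⊕ ι → ι := Sum.elim id id

theorem isDoubleLabel_of_swap (Q : AugLCP ι) {x : (ι → ℝ) × ℝ} {κ : ι ⊕ ι}
    (h1 : Q.constraintValue x κ = 0) (h2 : Q.constraintValue x κ.swap = 0) :
    Q.IsDoubleLabel x (label κ) := by
  cases κ with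
  | inl k => exact ⟨h1, h2⟩
  | inr k => exact ⟨h2, h1⟩

theorem IsDoubleLabel.tight {Q : AugLCP ι} {x : (ι → ℝ) × ℝ} {κ : ι ⊕ ι}
    (h : Q.IsDoubleLabel x (label κ)) : Q.constraintValue x κ = 0 := by
  cases κ with
  | inl k => exact h.1
  | inr k => exact h.2

theorem eq_or_eq_swap_of_label_eq {κ κ' : ι ⊕ ι} (h : label κ = label κ') :
    κ = κ' ∨ κ = κ'.swap := by
  cases κ <;> cases κ' <;> simp_all [label]

@[simp] theorem label_swap (κ : ι ⊕ ι) : label κ.swap = label κ := by cases κ <;> rfl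

theorem swap_ne (κ : ι ⊕ ι) : κ.swap ≠ κ := by cases κ <;> simp

@[simp] theorem label_relaxed (Q : AugLCP ι) (x : (ι → ℝ) × ℝ) (k : ι) :
    label (Q.relaxed x k) = k := by
  unfold relaxed; split_ifs <;> rfl

/-- At a vertex with a single double label, the relaxation of one of its two constraints gives
a line. -/
theorem exists_direction [Fintype ι] (Q : AugLCP ι) {x : (ι → ℝ) × ℝ} (hx : x ∈ Q.vertices)
    (hz : 0 < x.2) {κ : ι ⊕ ι}
    (hu : ∀ a, Q.IsDoubleLabel x a → a = label κ) :
    ∃ d : (ι → ℝ) × ℝ, Q.constraintDir κ d = 1 ∧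
      ∀ κ', κ' ≠ κ → Q.constraintValue x κ' = 0 → Q.constraintDir κ' d = 0 := by
  classical
  -- One constraint per label, chosen so that every tight constraint other than `κ` is listed.
  -- Together with `κ` these are as many linear forms as the dimension of the space, so injectivity
  -- gives surjectivity.
  let c : ι → ι ⊕ ι := fun a => if a = label κ then κ.swap else
    if x.1 a = 0 then Sum.inl a else Sum.inr a
  have hc : ∀ κ', κ' ≠ κ → Q.constraintValue x κ' = 0 → c (label κ') = κ' := by
    intro κ' hne ht
    by_cases hl : label κ' = label κ
    · rcases eq_or_eq_swap_of_label_eq hl with h | h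
      · exact absurd h hne
      · simp [c, h]
    · cases κ' with
      | inl a =>
        have ht : x.1 a = 0 := ht
        simp only [label, Sum.elim_inl, id] at hl
        simp [c, label, hl, ht]
      | inr a =>
        simp only [label, Sum.elim_inr, id] at hl
        have : x.1 a ≠ 0 := fun h0 => hl (hu a ⟨h0, ht⟩)
        simp [c, label, hl, this]
  let Φ : ((ι → ℝ) × ℝ) →ₗ[ℝ] ((ι → ℝ) × ℝ) :=
    (LinearMap.pi fun a => Q.constraintDir (c a)).prod (Q.constraintDir κ)
  have hinj : Function.Injective Φ := by
    rw [← LinearMap.ker_eq_bot, LinearMap.ker_eq_bot']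
    intro d hd
    refine Q.eq_zero_of_mem_vertices hx hz fun κ' ht => ?_
    by_cases hne : κ' = κ
    · subst hne; exact congrArg Prod.snd hd
    · rw [← hc κ' hne ht]
      exact congrFun (congrArg Prod.fst hd) (label κ')
  obtain ⟨d, hd⟩ := LinearMap.injective_iff_surjective.1 hinj (0, 1)
  refine ⟨d, congrArg Prod.snd hd, fun κ' hne ht => ?_⟩
  rw [← hc κ' hne ht]
  exact congrFun (congrArg Prod.fst hd) (label κ')

/-- The points of a pivot edge lie on a half-line. -/
theorem eq_add_smul_of_mem_pivotEdge [Finite ι] (Q : AugLCP ι) {x d x' : (ι → ℝ) × ℝ}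
    {κ : ι ⊕ ι} (hx : x ∈ Q.vertices) (hz : 0 < x.2) (hκ : Q.constraintValue x κ = 0)
    (hd1 : Q.constraintDir κ d = 1)
    (hd : ∀ κ', κ' ≠ κ → Q.constraintValue x κ' = 0 → Q.constraintDir κ' d = 0)
    (h : x' ∈ Q.pivotEdge x κ) :
    x' = x + Q.constraintValue x' κ • d := by
  have h0 : (x' - x) - Q.constraintValue x' κ • d = 0 := by
    refine Q.eq_zero_of_mem_vertices hx hz fun κ' ht => ?_
    rw [map_sub, ← constraintValue_sub, map_smul, smul_eq_mul]
    by_cases hne : κ' = κ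
    · subst hne; rw [hd1, ht]; ring
    · rw [h.2 κ' hne ht, ht, hd κ' hne ht]; ring
  rw [sub_sub, sub_eq_zero] at h0
  exact h0

theorem mem_pivotEdge_of_mem_polyhedron (Q : AugLCP ι) {x d : (ι → ℝ) × ℝ} {κ : ι ⊕ ι}
    (hd : ∀ κ', κ' ≠ κ → Q.constraintValue x κ' = 0 → Q.constraintDir κ' d = 0) {α : ℝ}
    (h : x + α • d ∈ Q.polyhedron) : x + α • d ∈ Q.pivotEdge x κ :=
  ⟨h, fun κ' hne ht => by rw [constraintValue_add_smul, ht, hd κ' hne ht]; ring⟩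

/-- Relaxing one constraint of a double label leaves its partner tight, so no complementarity
condition is lost. -/
theorem pivotEdge_subset_solutions (Q : AugLCP ι) {x : (ι → ℝ) × ℝ} (hs : x ∈ Q.solutions)
    {κ : ι ⊕ ι} (hκ : Q.IsDoubleLabel x (label κ)) : Q.pivotEdge x κ ⊆ Q.solutions := by
  intro x' h
  rw [mem_solutions_iff]
  refine ⟨h.1, fun κ' => ?_⟩
  by_cases h1 : κ' = κ
  · right
    subst h1
    exact h.2 _ (swap_ne κ') (IsDoubleLabel.tight (by simpa using hκ))
  · by_cases h2 : κ'.swap = κ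
    · left
      have : κ' = κ.swap := by rw [← h2, Sum.swap_swap]
      exact h.2 _ h1 (by rw [this]; exact IsDoubleLabel.tight (by simpa using hκ))
    · exact (((Q.mem_solutions_iff x).1 hs).2 κ').imp (h.2 κ' h1) (h.2 _ h2)

/-- A pivot edge is a half-line or a segment that ends where a further constraint is tight. -/
theorem pivotEdge_alternative [Finite ι] (Q : AugLCP ι) {x d : (ι → ℝ) × ℝ}
    {κ : ι ⊕ ι} (hx : x ∈ Q.vertices) (hz : 0 < x.2) (hκ : Q.constraintValue x κ = 0)
    (hd1 : Q.constraintDir κ d = 1)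
    (hd : ∀ κ', κ' ≠ κ → Q.constraintValue x κ' = 0 → Q.constraintDir κ' d = 0) :
    (∀ α : ℝ, 0 ≤ α → x + α • d ∈ Q.polyhedron) ∨
    ∃ α : ℝ, 0 < α ∧ Q.pivotEdge x κ = segment ℝ x (x + α • d) ∧
      ((x + α • d).2 = 0 ∨
        ∃ κ', 0 < Q.constraintValue x κ' ∧ Q.constraintValue (x + α • d) κ' = 0) := by
  by_cases hall : ∀ α : ℝ, 0 ≤ α → x + α • d ∈ Q.polyhedron
  · exact Or.inl hall
  right
  push Not at hall
  obtain ⟨β, hβ0, hβ⟩ := hall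
  -- The feasible parameters form a closed interval that starts at `0` and is bounded by `β`; its
  -- maximum is the end of the edge.
  let s : Set ℝ := {α | 0 ≤ α ∧ x + α • d ∈ Q.polyhedron}
  have hconv : ∀ α ∈ s, ∀ γ, 0 ≤ γ → γ ≤ α → γ ∈ s := by
    intro α hα γ h0 h1
    refine ⟨h0, ?_⟩
    rcases hα.1.eq_or_lt with h | h
    · have : γ = 0 := by linarith
      subst this; simpa using hx.1
    · have : x + γ • d = (1 - γ / α) • x + (γ / α) • (x + α • d) := by
        have : γ = (γ / α) * α := by field_simp
        conv_lhs => rw [this]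
        module
      rw [this]
      exact Q.convex_polyhedron hx.1 hα.2 (by rw [sub_nonneg, div_le_one h]; exact h1)
        (by positivity) (by ring)
  have hbdd : ∀ α ∈ s, α ≤ β := by
    intro α hα
    by_contra hlt
    exact hβ (hconv α hα β hβ0 (not_le.1 hlt).le).2
  have hclosed : IsClosed s := by
    have : s = {α | 0 ≤ α} ∩ ((⋂ κ', {α : ℝ | 0 ≤ Q.constraintValue x κ' +
        α * Q.constraintDir κ' d}) ∩ {α | 0 ≤ x.2 + α * d.2}) := by
      ext α
      simp [s, mem_polyhedron_iff, constraintValue_add_smul]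
    rw [this]
    refine (isClosed_le continuous_const continuous_id).inter (IsClosed.inter
      (isClosed_iInter fun κ' => isClosed_le continuous_const (by fun_prop))
      (isClosed_le continuous_const (by fun_prop)))
  have h0 : (0 : ℝ) ∈ s := ⟨le_rfl, by simpa using hx.1⟩
  have hmem := hclosed.csSup_mem ⟨0, h0⟩ ⟨β, hbdd⟩
  set α := sSup s with hαdef
  have hle : ∀ γ ∈ s, γ ≤ α := fun γ hγ => le_csSup ⟨β, hbdd⟩ hγ
  have hev := Q.eventually_mem_polyhedron (d := d) hx.1 hz (fun κ' ht => by
    by_cases hne : κ' = κ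
    · subst hne; rw [hd1]; norm_num
    · rw [hd κ' hne ht])
  obtain ⟨t, ht, ht0⟩ := (hev.and self_mem_nhdsWithin).exists
  have ht0 : (0 : ℝ) < t := ht0
  have hαpos : 0 < α := ht0.trans_le (hle t ⟨ht0.le, ht⟩)
  refine ⟨α, hαpos, ?_, ?_⟩
  · ext x'
    rw [segment_eq_image']
    constructor
    · intro h
      have hx' := Q.eq_add_smul_of_mem_pivotEdge hx hz hκ hd1 hd h
      set γ := Q.constraintValue x' κ
      have hγ0 : 0 ≤ γ := ((Q.mem_polyhedron_iff x').1 h.1).1 κ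
      have hγ : γ ≤ α := hle γ ⟨hγ0, by rw [← hx']; exact h.1⟩
      refine ⟨γ / α, ⟨by positivity, by rw [div_le_one hαpos]; exact hγ⟩, ?_⟩
      rw [hx']
      simp only [add_sub_cancel_left, smul_smul]
      rw [div_mul_cancel₀ _ hαpos.ne']
    · rintro ⟨t, ⟨h1, h2⟩, rfl⟩
      simp only [add_sub_cancel_left, smul_smul]
      exact Q.mem_pivotEdge_of_mem_polyhedron hd
        (hconv α hmem _ (by positivity) (by nlinarith)).2
  -- With `z > 0` and no newly tight constraint, one could travel a little beyond the maximum.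
  · by_contra hcon
    push Not at hcon
    have hz' : 0 < (x + α • d).2 :=
      lt_of_le_of_ne ((Q.mem_polyhedron_iff _).1 hmem.2).2 (Ne.symm hcon.1)
    have hev := Q.eventually_mem_polyhedron (d := d) hmem.2 hz' (fun κ' ht => by
      by_cases hne : κ' = κ
      · subst hne; rw [hd1]; norm_num
      · have h1 : ¬ 0 < Q.constraintValue x κ' := fun h => hcon.2 κ' h ht
        have h2 := ((Q.mem_polyhedron_iff _).1 hx.1).1 κ'
        rw [hd κ' hne (le_antisymm (not_lt.1 h1) h2)])
    obtain ⟨t, ht, ht0⟩ := (hev.and self_mem_nhdsWithin).exists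
    have ht0 : (0 : ℝ) < t := ht0
    have : α + t ∈ s := ⟨by positivity, by rw [add_smul, ← add_assoc]; exact ht⟩
    have := hle _ this
    linarith

theorem vertices_inter_segment (Q : AugLCP ι) {x u v : (ι → ℝ) × ℝ} (hx : x ∈ Q.vertices)
    (hu : u ∈ Q.polyhedron) (hv : v ∈ Q.polyhedron) (h : x ∈ segment ℝ u v) : x = u ∨ x = v := by
  rcases (mem_extremePoints_iff_forall_segment.1 hx).2 u hu v hv h with h | h
  exacts [Or.inl h.symm, Or.inr h.symm]

end AugLCP

/-! ### Regular regions and the path that Lemke's scheme follows in them -/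

namespace AugLCP

variable {ι : Type*}

/-- A region `Ω` in which Lemke's scheme, started at `(0, z₀)`, is nondegenerate, which it does
not leave, and in which all unbounded edges are primary. -/
structure Regular (Q : AugLCP ι) (Ω : Set ((ι → ℝ) × ℝ)) (z₀ : ℝ) : Prop where
  nondegenerate : ∀ x ∈ Q.solutions, x ∈ Ω → 0 < x.2 → ∀ k k',
    Q.IsDoubleLabel x k → Q.IsDoubleLabel x k' → k = k'
  closed : ∀ x x', x ∈ Ω → 0 < x.2 → segment ℝ x x' ⊆ Q.solutions → x' ∈ Ω
  ray : ∀ x d : (ι → ℝ) × ℝ, x ∈ Ω → 0 < x.2 → d ≠ 0 →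
    (∀ α : ℝ, 0 ≤ α → x + α • d ∈ Q.solutions) → x.1 = 0 ∧ d.1 = 0
  start_pos : 0 < z₀
  start_mem : ((0 : ι → ℝ), z₀) ∈ Ω
  start_sol : ∀ z, ((0 : ι → ℝ), z) ∈ Q.solutions ↔ z₀ ≤ z
  start_label : ∃ k, Q.slack (0, z₀) k = 0 ∧ 0 < Q.c k

theorem mem_solutions_of_fst_eq_zero (Q : AugLCP ι) {x : (ι → ℝ) × ℝ} (hx : x ∈ Q.polyhedron)
    (h : x.1 = 0) : x ∈ Q.solutions := ⟨hx, fun a => by simp [h]⟩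

namespace Regular

variable {Q : AugLCP ι} {Ω : Set ((ι → ℝ) × ℝ)} {z₀ : ℝ}

/-- If the start lies inside a segment of the polyhedron, both ends have `y = 0`, and `z₀` is the
least value of `z` there. -/
theorem start_mem_vertices (H : Q.Regular Ω z₀) : ((0 : ι → ℝ), z₀) ∈ Q.vertices := by
  have h0 := (H.start_sol z₀).2 le_rfl
  refine ⟨h0.1, fun u hu v hv hmem => ?_⟩
  have hz : ∀ w ∈ Q.polyhedron, w.1 = 0 → z₀ ≤ w.2 := fun w hw hw1 => by
    have := Q.mem_solutions_of_fst_eq_zero hw hw1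
    rw [show w = (0, w.2) from Prod.ext hw1 rfl] at this
    exact (H.start_sol _).1 this
  have huv : ∀ a, u.1 a = 0 ∧ v.1 a = 0 := fun a =>
    Q.constraintValue_eq_zero_of_openSegment hu hv hmem (κ := Sum.inl a) rfl
  have hu1 : u.1 = 0 := funext fun a => (huv a).1
  have hv1 : v.1 = 0 := funext fun a => (huv a).2
  have h1 := hz u hu hu1
  have h2 := hz v hv hv1
  obtain ⟨a, b, ha, hb, hab, h⟩ := hmem
  have h3 : a * u.2 + b * v.2 = z₀ := congrArg Prod.snd h
  refine Prod.ext hu1 ?_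
  show u.2 = z₀
  have h4 := mul_nonneg ha.le (sub_nonneg.2 h1)
  have h5 := mul_nonneg hb.le (sub_nonneg.2 h2)
  obtain rfl : b = 1 - a := by linarith
  have h6 : a * (u.2 - z₀) = 0 := by linarith
  linarith [(mul_eq_zero.1 h6).resolve_left ha.ne']

/-- The points beyond `z₀` are inner points of the primary ray. -/
theorem vertex_eq_start (H : Q.Regular Ω z₀) {x : (ι → ℝ) × ℝ} (hx : x ∈ Q.vertices)
    (h1 : x.1 = 0) : x = (0, z₀) := by
  have hs := Q.mem_solutions_of_fst_eq_zero hx.1 h1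
  obtain ⟨y, z⟩ := x
  obtain rfl : y = 0 := h1
  have hz : z₀ ≤ z := (H.start_sol _).1 hs
  rcases hz.eq_or_lt with h | h
  · rw [h]
  · have hmem : ((0 : ι → ℝ), z) ∈ segment ℝ (0, z₀) (0, z + 1) := by
      have hpos : 0 < z + 1 - z₀ := by linarith
      refine ⟨1 / (z + 1 - z₀), (z - z₀) / (z + 1 - z₀), by positivity,
        div_nonneg (by linarith) hpos.le, by field_simp; ring, ?_⟩
      refine Prod.ext (by simp) ?_
      simp only [Prod.snd_add, Prod.smul_snd, smul_eq_mul]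
      field_simp
      ring
    rcases Q.vertices_inter_segment hx ((H.start_sol z₀).2 le_rfl).1
      ((H.start_sol (z + 1)).2 (by linarith)).1 hmem with h' | h'
    · exact h'
    · have : z = z + 1 := congrArg Prod.snd h'
      linarith

/-- The vertex `x` was reached along an edge from `prev`. -/
structure Arrived (Q : AugLCP ι) (Ω : Set ((ι → ℝ) × ℝ)) (prev x : (ι → ℝ) × ℝ) : Prop where
  vertex : x ∈ Q.vertices
  sol : x ∈ Q.solutions
  mem : x ∈ Ω
  pos : 0 < x.2
  ne : prev ≠ x
  label : ∃ k, Q.IsDoubleLabel x k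
  edge : ∀ k, Q.IsDoubleLabel x k → prev ∈ Q.pivotEdge x (Q.relaxed prev k).swap

/-- The edge that leaves `x`, reached from `prev`, is bounded and ends in `x'`. -/
structure Departs (Q : AugLCP ι) (Ω : Set ((ι → ℝ) × ℝ)) (prev x x' : (ι → ℝ) × ℝ) : Prop where
  ne : x' ≠ x
  vertex : x' ∈ Q.vertices
  sol : x' ∈ Q.solutions
  mem : x' ∈ Ω
  edge : ∀ k, Q.IsDoubleLabel x k → Q.pivotEdge x (Q.relaxed prev k) = segment ℝ x x'
  subset : segment ℝ x x' ⊆ Ω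
  arrived : 0 < x'.2 → Arrived Q Ω x x'

theorem segment_subset_of_closed (H : Q.Regular Ω z₀) {x x' : (ι → ℝ) × ℝ} (hx : x ∈ Ω)
    (hz : 0 < x.2) (h : segment ℝ x x' ⊆ Q.solutions) : segment ℝ x x' ⊆ Ω := by
  intro y hy
  refine H.closed x y hx hz (Set.Subset.trans ?_ h)
  exact (convex_segment x x').segment_subset (left_mem_segment ℝ x x') hy

/-- Since `c_k > 0`, the slack of the double label is positive beyond `z₀`. So the rule relaxes
`y_k`, and the ray along which the start was reached is the edge for the other constraint, `v_k`. -/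
theorem arrived_start (H : Q.Regular Ω z₀) : Arrived Q Ω (0, z₀ + 1) (0, z₀) := by
  obtain ⟨k, hk, hck⟩ := H.start_label
  have hs := (H.start_sol z₀).2 le_rfl
  have hd : Q.IsDoubleLabel (0, z₀) k := ⟨rfl, hk⟩
  refine ⟨H.start_mem_vertices, hs, H.start_mem, H.start_pos, by simp, ⟨k, hd⟩, fun k' hk' => ?_⟩
  obtain rfl := H.nondegenerate _ hs H.start_mem H.start_pos _ _ hk' hd
  have hsl : 0 < Q.slack (0, z₀ + 1) k' := by
    have : Q.slack (0, z₀ + 1) k' = Q.slack (0, z₀) k' + Q.c k' := by simp [slack]; ring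
    rw [this, hk]; linarith
  have hr : Q.relaxed (0, z₀ + 1) k' = Sum.inl k' := if_pos hsl
  rw [hr, Sum.swap_inl]
  refine ⟨((H.start_sol (z₀ + 1)).2 (by linarith)).1, fun κ hne ht => ?_⟩
  cases κ with
  | inl a => rfl
  | inr a =>
    exact absurd (congrArg Sum.inr (H.nondegenerate _ hs H.start_mem H.start_pos _ _ ⟨rfl, ht⟩ hd))
      hne

/-- An unbounded edge would be a half-line of solutions in `Ω`, hence part of `y = 0`, and its
vertex would be the start. There `hstart` says that `y_k` is relaxed, so `y_k` grows along the edge,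
which is impossible. Hence the edge ends, either at `z = 0` or where a new constraint becomes tight.
-/
theorem exists_departs [Fintype ι] (H : Q.Regular Ω z₀) {prev x : (ι → ℝ) × ℝ}
    (hA : Arrived Q Ω prev x)
    (hstart : x = (0, z₀) → ∀ k, Q.IsDoubleLabel x k → Q.relaxed prev k = Sum.inl k) :
    ∃ x', Departs Q Ω prev x x' := by
  obtain ⟨k, hk⟩ := hA.label
  have huniq : ∀ a, Q.IsDoubleLabel x a → a = k := fun a ha =>
    H.nondegenerate x hA.sol hA.mem hA.pos a k ha hk
  set κ := Q.relaxed prev k with hκdef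
  have hlab : label κ = k := label_relaxed Q prev k
  have hkκ : Q.IsDoubleLabel x (label κ) := by rwa [hlab]
  have hκ0 : Q.constraintValue x κ = 0 := hkκ.tight
  obtain ⟨d, hd1, hd⟩ := Q.exists_direction hA.vertex hA.pos (κ := κ) (by rwa [hlab])
  have hsub := Q.pivotEdge_subset_solutions hA.sol hkκ
  rcases Q.pivotEdge_alternative hA.vertex hA.pos hκ0 hd1 hd with hray | ⟨α, hα, hseg, hend⟩
  · exfalso
    have hd0 : d ≠ 0 := by rintro rfl; simp at hd1
    have h := H.ray x d hA.mem hA.pos hd0 fun α hα =>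
      hsub (Q.mem_pivotEdge_of_mem_polyhedron hd (hray α hα))
    have hx := H.vertex_eq_start hA.vertex h.1
    rw [hstart hx k hk] at hκdef
    rw [hκdef] at hd1
    have : d.1 k = 1 := hd1
    rw [h.2] at this
    simp at this
  · set x' := x + α • d with hx'
    have hsegsol : segment ℝ x x' ⊆ Q.solutions := hseg ▸ hsub
    have hx's : x' ∈ Q.solutions := hsegsol (right_mem_segment ℝ x x')
    have hsegΩ := H.segment_subset_of_closed hA.mem hA.pos hsegsol
    have hx'Ω := hsegΩ (right_mem_segment ℝ x x')
    have hκx' : Q.constraintValue x' κ = α := by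
      rw [hx', constraintValue_add_smul, hκ0, hd1]; ring
    have hne : x' ≠ x := fun h => by rw [h, hκ0] at hκx'; exact hα.ne hκx'
    have hpe : x' ∈ Q.pivotEdge x κ := hseg ▸ right_mem_segment ℝ x x'
    have hvert : x' ∈ Q.vertices := by
      refine ⟨hx's.1, fun u hu v hv hmem => ?_⟩
      have hline : ∀ w ∈ Q.polyhedron, (∀ κ', Q.constraintValue x' κ' = 0 →
          Q.constraintValue w κ' = 0) → w = x + Q.constraintValue w κ • d := fun w hw h =>
        Q.eq_add_smul_of_mem_pivotEdge hA.vertex hA.pos hκ0 hd1 hd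
          ⟨hw, fun κ' hne ht => h κ' (hpe.2 κ' hne ht)⟩
      have hu1 := hline u hu fun κ' h =>
        (Q.constraintValue_eq_zero_of_openSegment hu hv hmem h).1
      set γ := Q.constraintValue u κ
      suffices hγ : γ = α by rw [hu1, hγ]
      rcases hend with hz | ⟨κ', hpos, hzero⟩
      · have huz : u.2 = 0 := by
          obtain ⟨a, b, ha, hb, -, h⟩ := hmem
          have h3 : a * u.2 + b * v.2 = x'.2 := congrArg Prod.snd h
          rw [hz] at h3
          have h4 := mul_nonneg ha.le hu.2.2
          have h5 := mul_nonneg hb.le hv.2.2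
          exact (mul_eq_zero.1 (by linarith : a * u.2 = 0)).resolve_left ha.ne'
        have h1 : x.2 + γ * d.2 = 0 := by rw [← huz, hu1]; rfl
        have h2 : x.2 + α * d.2 = 0 := hz
        have h3 : (γ - α) * d.2 = 0 := by linarith
        rcases mul_eq_zero.1 h3 with h | h
        · linarith
        · have := hA.pos; rw [h] at h2; linarith
      · have h1 := (Q.constraintValue_eq_zero_of_openSegment hu hv hmem hzero).1
        rw [hu1, constraintValue_add_smul] at h1
        rw [hx', constraintValue_add_smul] at hzero
        have h3 : (γ - α) * Q.constraintDir κ' d = 0 := by linarith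
        rcases mul_eq_zero.1 h3 with h | h
        · linarith
        · rw [h] at hzero; linarith
    refine ⟨x', hne, hvert, hx's, hx'Ω, fun a ha => ?_, hsegΩ, fun hz' => ?_⟩
    · rw [huniq a ha]; exact hseg
    · obtain ⟨κ', hpos, hzero⟩ := hend.resolve_left hz'.ne'
      have hcompl : ∀ κ₁, 0 < Q.constraintValue x κ₁ → Q.constraintValue x κ₁.swap = 0 :=
        fun κ₁ h => (((Q.mem_solutions_iff x).1 hA.sol).2 κ₁).resolve_left h.ne'
      -- A constraint that becomes tight at `x'` was positive at `x`, so its partner was tight at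
      -- `x` and was kept tight: it creates a double label at `x'`.
      have hkeep : ∀ κ₁, 0 < Q.constraintValue x κ₁ → Q.constraintValue x' κ₁ = 0 →
          Q.IsDoubleLabel x' (label κ₁) := by
        intro κ₁ h1 h2
        refine Q.isDoubleLabel_of_swap h2 (hpe.2 _ (fun h => ?_) (hcompl κ₁ h1))
        have h3 : Q.constraintValue x κ₁ = 0 := by
          apply IsDoubleLabel.tight
          rw [← label_swap, h]
          exact hkκ
        exact h1.ne' h3
      have hlab' := hkeep κ' hpos hzero
      refine ⟨hvert, hx's, hx'Ω, hz', hne.symm, ⟨_, hlab'⟩, fun a ha => ?_⟩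
      have haκ : a = label κ' := H.nondegenerate x' hx's hx'Ω hz' _ _ ha hlab'
      -- The pivoting rule relaxes the partner of the constraint `κ'` that has just become tight;
      -- relaxing `κ'` itself would lead back.
      have hrel : (Q.relaxed x a).swap = κ' := by
        subst haκ
        cases κ' with
        | inl b =>
          have hb : Q.slack x b = 0 := hcompl _ hpos
          simp [relaxed, label, hb]
        | inr b =>
          have hb : 0 < Q.slack x b := hpos
          simp [relaxed, label, hb]
      rw [hrel]
      -- A further newly tight constraint would by `hkeep` have the same label as `κ'`, so it would
      -- be the partner of `κ'`, which was tight at `x`.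
      refine ⟨hA.sol.1, fun κ₁ hne₁ ht => ?_⟩
      by_contra h0
      have h1 : 0 < Q.constraintValue x κ₁ :=
        lt_of_le_of_ne (((Q.mem_polyhedron_iff x).1 hA.sol.1).1 κ₁) (Ne.symm h0)
      have h2 := H.nondegenerate x' hx's hx'Ω hz' _ _ (hkeep κ₁ h1 ht) hlab'
      rcases eq_or_eq_swap_of_label_eq h2 with h | h
      · exact hne₁ h
      · exact h0 (h ▸ hcompl κ' hpos)

open Classical in
/-- The next vertex (or `x` if there is none). -/
noncomputable def nextVertex (Q : AugLCP ι) (Ω : Set ((ι → ℝ) × ℝ)) (prev x : (ι → ℝ) × ℝ) :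
    (ι → ℝ) × ℝ :=
  if h : ∃ x', Departs Q Ω prev x x' then h.choose else x

theorem departs_nextVertex {prev x : (ι → ℝ) × ℝ} (h : ∃ x', Departs Q Ω prev x x') :
    Departs Q Ω prev x (nextVertex Q Ω prev x) := by
  unfold nextVertex
  rw [dif_pos h]
  exact h.choose_spec

/-- The previous and the current point after `t` pivots. -/
noncomputable def orbit (Q : AugLCP ι) (Ω : Set ((ι → ℝ) × ℝ)) (z₀ : ℝ) :
    ℕ → ((ι → ℝ) × ℝ) × ((ι → ℝ) × ℝ)
  | 0 => ((0, z₀ + 1), (0, z₀))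
  | t + 1 => ((orbit Q Ω z₀ t).2, nextVertex Q Ω (orbit Q Ω z₀ t).1 (orbit Q Ω z₀ t).2)

/-- The vertices of the path. -/
noncomputable def path (Q : AugLCP ι) (Ω : Set ((ι → ℝ) × ℝ)) (z₀ : ℝ) (t : ℕ) :
    (ι → ℝ) × ℝ := (orbit Q Ω z₀ t).2

theorem previous_path (t : ℕ) : previous (path Q Ω z₀) t = (orbit Q Ω z₀ t).1 := by
  cases t <;> rfl

theorem path_succ (t : ℕ) : path Q Ω z₀ (t + 1) =
    nextVertex Q Ω (previous (path Q Ω z₀) t) (path Q Ω z₀ t) := by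
  rw [previous_path]; rfl

/-- Two edges that leave a vertex have only that vertex in common. -/
theorem eq_of_mem_two_edges [Fintype ι] {x u : (ι → ℝ) × ℝ} (hx : x ∈ Q.vertices) (hz : 0 < x.2)
    {κ : ι ⊕ ι} (h1 : u ∈ Q.pivotEdge x κ) (h2 : u ∈ Q.pivotEdge x κ.swap) : u = x := by
  refine Q.eq_of_tight_imp_tight hx hz fun κ' ht => ?_
  by_cases h : κ' = κ
  · exact h2.2 κ' (by rw [h]; exact (swap_ne κ).symm) ht
  · exact h1.2 κ' h ht

theorem exists_smul_of_mem_pivotEdge [Fintype ι] {x u v : (ι → ℝ) × ℝ} {κ : ι ⊕ ι}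
    (hx : x ∈ Q.vertices) (hz : 0 < x.2) (hk : ∀ a, Q.IsDoubleLabel x a ↔ a = label κ)
    (hu : u ∈ Q.pivotEdge x κ) (hv : v ∈ Q.pivotEdge x κ) (hvx : v ≠ x) :
    ∃ γ : ℝ, 0 ≤ γ ∧ u = x + γ • (v - x) := by
  obtain ⟨d, hd1, hd⟩ := Q.exists_direction hx hz (fun a ha => (hk a).1 ha)
  have hκ0 : Q.constraintValue x κ = 0 := ((hk _).2 rfl).tight
  have hu1 := Q.eq_add_smul_of_mem_pivotEdge hx hz hκ0 hd1 hd hu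
  have hv1 := Q.eq_add_smul_of_mem_pivotEdge hx hz hκ0 hd1 hd hv
  have hu0 := ((Q.mem_polyhedron_iff u).1 hu.1).1 κ
  have hv0 := ((Q.mem_polyhedron_iff v).1 hv.1).1 κ
  have hvne : Q.constraintValue v κ ≠ 0 := fun h => hvx (by rw [hv1, h]; simp)
  refine ⟨Q.constraintValue u κ / Q.constraintValue v κ, div_nonneg hu0 hv0, ?_⟩
  have h3 : v - x = Q.constraintValue v κ • d := sub_eq_iff_eq_add'.2 hv1
  rw [h3, smul_smul, div_mul_cancel₀ _ hvne]
  exact hu1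

/-- A pivot edge contains at most one further vertex. -/
theorem vertex_unique_of_mem_pivotEdge [Fintype ι] {x u v : (ι → ℝ) × ℝ} {κ : ι ⊕ ι}
    (hx : x ∈ Q.vertices) (hz : 0 < x.2) (hk : ∀ a, Q.IsDoubleLabel x a ↔ a = label κ)
    (hu : u ∈ Q.pivotEdge x κ) (hv : v ∈ Q.pivotEdge x κ) (hux : u ≠ x) (hvx : v ≠ x)
    (huv : u ∈ Q.vertices) (hvv : v ∈ Q.vertices) : u = v := by
  have key : ∀ u v : (ι → ℝ) × ℝ, v ∈ Q.vertices → u ∈ Q.vertices → v ≠ x → ∀ γ : ℝ, 1 ≤ γ →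
      u = x + γ • (v - x) → u = v := by
    intro u v hv hu hvx γ hγ h
    have hmem : v ∈ segment ℝ x u := by
      rw [segment_eq_image']
      refine ⟨1 / γ, ⟨by positivity, by rw [div_le_one (by linarith)]; exact hγ⟩, ?_⟩
      have hγ0 : γ ≠ 0 := by linarith
      simp [h, smul_smul, hγ0]
    exact ((Q.vertices_inter_segment hv hx.1 hu.1 hmem).resolve_left hvx).symm
  obtain ⟨γ, hγ, h⟩ := exists_smul_of_mem_pivotEdge hx hz hk hu hv hvx
  rcases le_total 1 γ with h1 | h1
  · exact key u v hvv huv hvx γ h1 h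
  · have hγ0 : γ ≠ 0 := fun h0 => hux (by rw [h, h0]; simp)
    have hγp : 0 < γ := lt_of_le_of_ne hγ hγ0.symm
    refine (key v u huv hvv hux γ⁻¹ ((one_le_inv₀ hγp).2 h1) ?_).symm
    simp [h, smul_smul, hγ0]

/-- The heart is that no vertex is repeated. Suppose `S (b + 1) = S a` with `a ≤ b`. At this vertex
there are only two edges, the outgoing and the incoming one, and `S b` lies on one of them. So `S b`
is the successor or the predecessor of `S a` on the path (or lies on the primary ray, if `a = 0`),
which contradicts earlier steps. -/
theorem path_invariant [Fintype ι] (H : Q.Regular Ω z₀) (t : ℕ)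
    (hpos : ∀ s < t, 0 < (path Q Ω z₀ s).2) :
    (path Q Ω z₀ t ∈ Q.vertices ∧ path Q Ω z₀ t ∈ Q.solutions ∧ path Q Ω z₀ t ∈ Ω) ∧
    (0 < (path Q Ω z₀ t).2 →
      Arrived Q Ω (previous (path Q Ω z₀) t) (path Q Ω z₀ t) ∧
      Departs Q Ω (previous (path Q Ω z₀) t) (path Q Ω z₀ t) (path Q Ω z₀ (t + 1))) ∧
    ∀ s < t, path Q Ω z₀ s ≠ path Q Ω z₀ t := by
  induction t using Nat.strong_induction_on with
  | _ t ih =>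
  have hdep : ∀ s < t, Arrived Q Ω (previous (path Q Ω z₀) s) (path Q Ω z₀ s) ∧
      Departs Q Ω (previous (path Q Ω z₀) s) (path Q Ω z₀ s) (path Q Ω z₀ (s + 1)) :=
    fun s hs => (ih s hs fun r hr => hpos r (hr.trans hs)).2.1 (hpos s hs)
  have hinj : ∀ s < t, ∀ r < s, path Q Ω z₀ r ≠ path Q Ω z₀ s :=
    fun s hs r hr => (ih s hs fun r hr => hpos r (hr.trans hs)).2.2 r hr
  set S := path Q Ω z₀ with hS
  rcases Nat.eq_zero_or_pos t with rfl | ht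
  · have hA : Arrived Q Ω (previous S 0) (S 0) := H.arrived_start
    refine ⟨⟨hA.vertex, hA.sol, hA.mem⟩, fun _ => ⟨hA, ?_⟩, fun s hs => absurd hs (Nat.not_lt_zero s)⟩
    rw [hS, path_succ]
    refine departs_nextVertex (H.exists_departs hA fun _ k hk => ?_)
    have h1 := (hA.edge k hk).2
    by_contra hne
    have hr : Q.relaxed (previous S 0) k = Sum.inr k := by
      unfold relaxed at hne ⊢
      split_ifs at hne ⊢ with h
      · exact absurd rfl hne
      · rfl
    rw [hr] at h1
    have h2 : Q.slack (0, z₀ + 1) k = 0 := h1 (Sum.inr k) (by simp) hk.2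
    obtain ⟨k', hk', hck⟩ := H.start_label
    obtain rfl := H.nondegenerate _ hA.sol hA.mem hA.pos k k' hk ⟨rfl, hk'⟩
    have h3 : Q.slack (0, z₀ + 1) k = Q.slack (0, z₀) k + Q.c k := by simp [slack]; ring
    rw [h2, hk'] at h3
    linarith
  obtain ⟨b, rfl⟩ : ∃ b, t = b + 1 := ⟨t - 1, by omega⟩
  obtain ⟨hAb, hDb⟩ := hdep b (Nat.lt_succ_self b)
  have hnew : ∀ a < b + 1, S a ≠ S (b + 1) := by
    intro a ha hab
    have hza := hpos a ha
    have hArr : Arrived Q Ω (S b) (S (b + 1)) := hDb.arrived (hab ▸ hza)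
    obtain ⟨hAa, hDa⟩ := hdep a ha
    obtain ⟨k, hk⟩ := hAa.label
    have hku : ∀ k', Q.IsDoubleLabel (S a) k' ↔ k' = k := fun k' =>
      ⟨fun h => H.nondegenerate _ hAa.sol hAa.mem hAa.pos _ _ h hk, fun h => h ▸ hk⟩
    have hbe := hArr.edge k (hab ▸ hk)
    rw [← hab] at hbe
    have hSb : S b ≠ S a := hab ▸ hDb.ne.symm
    have hlab : label (Q.relaxed (S b) k).swap = label (Q.relaxed (previous S a) k) := by simp
    rcases eq_or_eq_swap_of_label_eq hlab with h | h
    -- `S b` on the outgoing edge: then `b = a + 1`, and the path would turn back at `S b` although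
    -- its incoming and outgoing edges meet only in that vertex.
    · rw [h, hDa.edge k hk] at hbe
      have h1 := (Q.vertices_inter_segment hAb.vertex hAa.vertex.1 hDa.vertex.1 hbe).resolve_left
        hSb
      have hab' : a < b := by
        rcases Nat.lt_succ_iff_lt_or_eq.1 ha with h | h
        · exact h
        · subst h; exact absurd rfl hSb
      have h2 : a + 1 = b := by
        by_contra hne
        exact hinj b (Nat.lt_succ_self b) (a + 1) (by omega) h1.symm
      subst h2
      obtain ⟨l, hl⟩ := hAb.label
      have h3 := hAb.edge l hl
      have h4 : S (a + 1 + 1) ∈ Q.pivotEdge (S (a + 1)) (Q.relaxed (previous S (a + 1)) l) := by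
        rw [hDb.edge l hl]; exact right_mem_segment ℝ _ _
      rw [← hab] at h4
      exact hSb (eq_of_mem_two_edges hAb.vertex hAb.pos h4 h3).symm
    -- `S b` on the incoming edge: it is the previous vertex, or, for `a = 0`, a vertex on the
    -- primary ray, hence the start.
    · rw [h] at hbe
      have hae := hAa.edge k hk
      have hku' : ∀ k', Q.IsDoubleLabel (S a) k' ↔
          k' = label (Q.relaxed (previous S a) k).swap := by simpa using hku
      rcases Nat.eq_zero_or_pos a with rfl | ha0
      · obtain ⟨γ, hγ, h1⟩ := exists_smul_of_mem_pivotEdge hAa.vertex hAa.pos hku' hbe hae hAa.ne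
        have h2 : (S b).1 = 0 := by
          rw [h1]
          have h5 : S 0 = (0, z₀) := rfl
          have h6 : previous S 0 = (0, z₀ + 1) := rfl
          rw [h5, h6]
          simp
        exact hSb (H.vertex_eq_start hAb.vertex h2)
      · obtain ⟨c, rfl⟩ : ∃ c, a = c + 1 := ⟨a - 1, by omega⟩
        have h1 : S b = S c := vertex_unique_of_mem_pivotEdge hAa.vertex hAa.pos hku' hbe hae hSb
          hAa.ne hAb.vertex (hdep c (by omega)).1.vertex
        exact hinj b (Nat.lt_succ_self b) c (by omega) h1.symm
  refine ⟨⟨hDb.vertex, hDb.sol, hDb.mem⟩, fun hz => ?_, hnew⟩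
  have hArr := hDb.arrived hz
  refine ⟨hArr, ?_⟩
  rw [hS, path_succ (b + 1)]
  exact departs_nextVertex (H.exists_departs hArr fun h => absurd h.symm (hnew 0 (Nat.succ_pos b)))

/-- An endless path would consist of distinct vertices with `z > 0`, and these have distinct sets of
tight constraints, of which there are finitely many. -/
theorem exists_path_end [Fintype ι] (H : Q.Regular Ω z₀) :
    ∃ T, (path Q Ω z₀ T).2 = 0 ∧ ∀ t < T, 0 < (path Q Ω z₀ t).2 := by
  classical
  by_cases hall : ∀ t, 0 < (path Q Ω z₀ t).2
  · exfalso
    have hinj : Function.Injective fun t => {κ | Q.constraintValue (path Q Ω z₀ t) κ = 0} := by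
      intro s t hst
      have hinv := fun t => H.path_invariant t fun s _ => hall s
      have heq : path Q Ω z₀ s = path Q Ω z₀ t :=
        Q.eq_of_tight_imp_tight (hinv t).1.1 (hall t) fun κ h =>
          (Set.ext_iff.1 hst κ).2 h
      rcases lt_trichotomy s t with h | h | h
      · exact absurd heq ((hinv t).2.2 s h)
      · exact h
      · exact absurd heq.symm ((hinv s).2.2 t h)
    exact not_injective_infinite_finite _ hinj
  · push Not at hall
    refine ⟨Nat.find hall, ?_, fun t ht => not_le.1 (Nat.find_min hall ht)⟩
    have hinv := H.path_invariant (Nat.find hall) fun t ht => not_le.1 (Nat.find_min hall ht)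
    exact le_antisymm (Nat.find_spec hall) hinv.1.1.1.2.2

/-- Lemke's scheme works in a regular region. -/
theorem exists_run [Fintype ι] (H : Q.Regular Ω z₀) :
    ∃ (T : ℕ) (S : ℕ → (ι → ℝ) × ℝ),
      Q.IsRun z₀ S T ∧ (S T).2 = 0 ∧
      (∀ t ≤ T, S t ∈ Q.vertices ∧ S t ∈ Q.solutions ∧ S t ∈ Ω) ∧
      (∀ t < T, ∃! k, Q.IsDoubleLabel (S t) k) ∧
      (∀ (T' : ℕ) (S' : ℕ → (ι → ℝ) × ℝ), Q.IsRun z₀ S' T' → T' ≤ T ∧ ∀ t ≤ T', S' t = S t) ∧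
      ∀ t < T,
        (∀ k, Q.IsDoubleLabel (S t) k →
          Q.pivotEdge (S t) (Q.relaxed (previous S t) k) = segment ℝ (S t) (S (t + 1))) ∧
        segment ℝ (S t) (S (t + 1)) ⊆ Ω ∩ Q.solutions := by
  obtain ⟨T, hT, hpos⟩ := H.exists_path_end
  set S := path Q Ω z₀ with hS
  have hinv := fun t (ht : t ≤ T) => H.path_invariant t fun s hs => hpos s (hs.trans_le ht)
  have hAD := fun t (ht : t < T) => (hinv t ht.le).2.1 (hpos t ht)
  refine ⟨T, S, ⟨rfl, fun t ht => ⟨hpos t ht, ?_⟩⟩, hT, fun t ht => (hinv t ht).1, fun t ht => ?_,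
    fun T' S' hrun => ?_, fun t ht => ⟨(hAD t ht).2.edge, fun x hx => ⟨(hAD t ht).2.subset hx, ?_⟩⟩⟩
  · obtain ⟨hA, hD⟩ := hAD t ht
    obtain ⟨k, hk⟩ := hA.label
    refine ⟨k, hk, hD.ne, hD.vertex, ?_⟩
    rw [hD.edge k hk]
    exact right_mem_segment ℝ _ _
  · obtain ⟨hA, hD⟩ := hAD t ht
    obtain ⟨k, hk⟩ := hA.label
    exact ⟨k, hk, fun k' hk' => H.nondegenerate _ hA.sol hA.mem hA.pos _ _ hk' hk⟩
  -- Any other run sees the same previous point, the same double label and the same edge, and the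
  -- far end is the only further vertex on it.
  · suffices h : ∀ t ≤ T', t ≤ T ∧ ∀ s ≤ t, S' s = S s from
      ⟨(h T' le_rfl).1, (h T' le_rfl).2⟩
    intro t
    induction t with
    | zero => exact fun _ => ⟨Nat.zero_le T, fun s hs => by rw [Nat.le_zero.1 hs]; exact hrun.1⟩
    | succ t ih =>
      intro ht
      obtain ⟨htT, hSt⟩ := ih (by omega)
      obtain ⟨hz, k, hk, hne, hv, he⟩ := hrun.2 t ht
      have hprev : previous S' t = previous S t := by
        cases t with
        | zero =>
          show ((0 : ι → ℝ), (S' 0).2 + 1) = (0, (S 0).2 + 1)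
          rw [hSt 0 le_rfl]
        | succ r => exact hSt r (Nat.le_succ r)
      rw [hprev] at he
      rw [hSt t le_rfl] at hz hk hne he
      have htT : t < T := lt_of_le_of_ne htT fun h => by rw [h, hT] at hz; exact lt_irrefl _ hz
      obtain ⟨hA, hD⟩ := hAD t htT
      rw [hD.edge k hk] at he
      refine ⟨htT, fun s hs => ?_⟩
      rcases Nat.le_succ_iff.1 hs with h | rfl
      · exact hSt s h
      · exact (Q.vertices_inter_segment hv hA.vertex.1 hD.vertex.1 he).resolve_left hne
  · obtain ⟨hA, hD⟩ := hAD t ht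
    obtain ⟨k, hk⟩ := hA.label
    rw [← hD.edge k hk] at hx
    exact Q.pivotEdge_subset_solutions hA.sol (by simpa using hk) hx

end Regular

end AugLCP

/-! ### Regularity of the complementarity problem of a strongly connected market -/

namespace Market

variable {N M : Type*}

theorem sgn_of_good {I : Market N M} {j : M} (h : I.IsGood j) : I.sgn j = 1 := if_pos h

theorem sgn_of_bad {I : Market N M} {j : M} (h : ¬ I.IsGood j) : I.sgn j = -1 := if_neg h

instance [Finite N] [Finite M] (I : Market N M) : Finite I.Var := by
  let g : (N ⊕ M) ⊕ ((Σ i : N, Σ j : M, Fin (I.K i j + 1)) ⊕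
      (Σ i : N, Σ j : M, Fin (I.K i j + 1))) → I.Var
    | Sum.inl (Sum.inl i) => .r i
    | Sum.inl (Sum.inr j) => .p j
    | Sum.inr (Sum.inl ⟨i, j, k⟩) => .f i j k
    | Sum.inr (Sum.inr ⟨i, j, k⟩) => .s i j k
  refine Finite.of_surjective g fun a => ?_
  cases a with
  | r i => exact ⟨Sum.inl (Sum.inl i), rfl⟩
  | p j => exact ⟨Sum.inl (Sum.inr j), rfl⟩
  | f i j k => exact ⟨Sum.inr (Sum.inl ⟨i, j, k⟩), rfl⟩
  | s i j k => exact ⟨Sum.inr (Sum.inr ⟨i, j, k⟩), rfl⟩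

noncomputable instance [Finite N] [Finite M] (I : Market N M) : Fintype I.Var := Fintype.ofFinite _

variable [Fintype N] [Fintype M] (I : Market N M) (P R : ℝ) (ε : M → ℝ)

/-! ## The slacks of the complementarity problem -/

/-- Total spending on a good, or earning on a bad. -/
def total {I : Market N M} (y : I.Var → ℝ) (j : M) : ℝ := ∑ i, ∑ k, y (.f i j k)

variable (x : (I.Var → ℝ) × ℝ)

/-- Here and below slacks are expressed through `P - p_j`, the absolute price of `j`, and `R - r_i`,
the inverse bang per buck of `i`. -/
theorem slack_r (i : N) : (I.lcp P R ε).slack x (.r i) =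
    ∑ j, I.sgn j * (I.W i j * (P - x.1 (.p j)) - ∑ k, x.1 (.f i j k)) + x.2 := by
  simp only [AugLCP.slack, lcp, lhs, LinearMap.coe_mk, AddHom.coe_mk, one_mul]
  rw [Finset.mul_sum, ← Finset.sum_sub_distrib]
  congr 1
  refine Finset.sum_congr rfl fun j _ => ?_
  ring

theorem slack_p_good {j : M} (h : I.IsGood j) : (I.lcp P R ε).slack x (.p j) =
    total x.1 j - (P - x.1 (.p j)) + (1 + ε j) * x.2 := by
  simp only [AugLCP.slack, lcp, lhs, LinearMap.coe_mk, AddHom.coe_mk, if_pos h, sgn_of_good h,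
    total]
  ring

theorem slack_p_bad {j : M} (h : ¬ I.IsGood j) : (I.lcp P R ε).slack x (.p j) =
    (P - x.1 (.p j)) - total x.1 j := by
  simp only [AugLCP.slack, lcp, lhs, LinearMap.coe_mk, AddHom.coe_mk, if_neg h, sgn_of_bad h,
    total]
  ring

theorem slack_f_good {j : M} (h : I.IsGood j) (i : N) (k : Fin (I.K i j + 1)) :
    (I.lcp P R ε).slack x (.f i j k) =
    (P - x.1 (.p j)) - I.U i j k * (R - x.1 (.r i)) + x.1 (.s i j k) + x.2 := by
  simp only [AugLCP.slack, lcp, lhs, LinearMap.coe_mk, AddHom.coe_mk, if_pos h, sgn_of_good h]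
  ring

theorem slack_f_bad {j : M} (h : ¬ I.IsGood j) (i : N) (k : Fin (I.K i j + 1)) :
    (I.lcp P R ε).slack x (.f i j k) =
    -(P - x.1 (.p j)) - I.U i j k * (R - x.1 (.r i)) + x.1 (.s i j k) := by
  simp only [AugLCP.slack, lcp, lhs, LinearMap.coe_mk, AddHom.coe_mk, if_neg h, sgn_of_bad h]
  ring

theorem slack_s (i : N) (j : M) (k : Fin (I.K i j + 1)) :
    (I.lcp P R ε).slack x (.s i j k) = I.L i j k * (P - x.1 (.p j)) - x.1 (.f i j k) := by
  simp only [AugLCP.slack, lcp, lhs, LinearMap.coe_mk, AddHom.coe_mk]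
  ring

variable {I P R ε} {x}

/-- Walras's law: because one unit of each item is supplied, the budget slacks add up to the signed
excess supplies, plus `z` for each agent. -/
theorem sum_slack_r (hI : I.IsSPLC) : ∑ i, (I.lcp P R ε).slack x (.r i) =
    ∑ j, I.sgn j * ((P - x.1 (.p j)) - total x.1 j) + Fintype.card N * x.2 := by
  simp only [slack_r, Finset.sum_add_distrib, Finset.sum_const, Finset.card_univ, nsmul_eq_mul]
  congr 1
  rw [Finset.sum_comm]
  refine Finset.sum_congr rfl fun j _ => ?_
  rw [← Finset.mul_sum, Finset.sum_sub_distrib, ← Finset.sum_mul, hI.supply j, one_mul, total]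

theorem slack_eq_zero (hx : x ∈ (I.lcp P R ε).solutions) {a : I.Var} (h : 0 < x.1 a) :
    (I.lcp P R ε).slack x a = 0 :=
  (mul_eq_zero.1 (hx.2 a)).resolve_left h.ne'

theorem spending_le_total {y : I.Var → ℝ} (hy : ∀ a, 0 ≤ y a) (i : N) (j : M) :
    ∑ k, y (.f i j k) ≤ total y j :=
  Finset.single_le_sum (f := fun i => ∑ k, y (.f i j k))
    (fun _ _ => Finset.sum_nonneg fun _ _ => hy _) (Finset.mem_univ i)

theorem f_le_total {y : I.Var → ℝ} (hy : ∀ a, 0 ≤ y a) (i : N) (j : M)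
    (k : Fin (I.K i j + 1)) : y (.f i j k) ≤ total y j :=
  (Finset.single_le_sum (f := fun k => y (.f i j k)) (fun _ _ => hy _)
    (Finset.mem_univ k)).trans (spending_le_total hy i j)

theorem f_le (hx : x ∈ (I.lcp P R ε).polyhedron) (i : N) (j : M) (k : Fin (I.K i j + 1)) :
    x.1 (.f i j k) ≤ I.L i j k * (P - x.1 (.p j)) := by
  have := hx.2.1 (.s i j k)
  rw [slack_s] at this
  linarith

theorem effective_price_nonneg [Nonempty N] (hI : I.IsSPLC)
    (hx : x ∈ (I.lcp P R ε).polyhedron) (j : M) : 0 ≤ P - x.1 (.p j) := by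
  have i := Classical.arbitrary N
  have h1 := f_le hx i j 0
  have h2 := hx.1 (.f i j 0)
  exact nonneg_of_mul_nonneg_right (h2.trans h1) (hI.length_pos i j 0)

theorem f_eq_zero (hx : x ∈ (I.lcp P R ε).polyhedron) {j : M} (hj : P - x.1 (.p j) = 0)
    (i : N) (k : Fin (I.K i j + 1)) : x.1 (.f i j k) = 0 := by
  have h1 := f_le hx i j k
  rw [hj, mul_zero] at h1
  exact le_antisymm h1 (hx.1 _)

theorem disutility_neg (hI : I.IsSPLC) {j : M} (hj : ¬ I.IsGood j) (i : N)
    (k : Fin (I.K i j + 1)) : I.U i j k < 0 :=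
  ((hI.slope_strictAnti i j).antitone (Fin.zero_le k)).trans_lt (hI.bad_neg j hj i)

theorem total_le_of_bad (hx : x ∈ (I.lcp P R ε).polyhedron) {j : M} (hj : ¬ I.IsGood j) :
    total x.1 j ≤ P - x.1 (.p j) := by
  have := hx.2.1 (.p j)
  rw [slack_p_bad I P R ε x hj] at this
  linarith

/-- An agent with `r_i = R` forces `z` and many prices to vanish. -/
theorem of_r_eq [Nonempty N] (hI : I.IsSPLC) (hR : 0 < R)
    (hx : x ∈ (I.lcp P R ε).solutions) {i : N} (hi : x.1 (.r i) = R) :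
    x.2 = 0 ∧ (∀ j, ¬ I.IsGood j → P - x.1 (.p j) = 0) ∧
      ∀ j, I.IsGood j → 0 < I.W i j → P - x.1 (.p j) = 0 := by
  have hπ := effective_price_nonneg hI hx.1
  -- With `λ_i = 0` a positive price of a bad forces `s > 0` on the last segment. So `f = L π > π`,
  -- while at most `π` is earned on `j` in total.
  have hbad : ∀ j, ¬ I.IsGood j → P - x.1 (.p j) = 0 := by
    intro j hj
    by_contra hne
    have hpos : 0 < P - x.1 (.p j) := lt_of_le_of_ne (hπ j) (Ne.symm hne)
    have h1 := hx.1.2.1 (.f i j (Fin.last _))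
    rw [slack_f_bad I P R ε x hj, hi] at h1
    have h2 : 0 < x.1 (.s i j (Fin.last _)) := by linarith
    have h3 := slack_eq_zero hx h2
    rw [slack_s] at h3
    have h4 := f_le_total hx.1.1 i j (Fin.last _)
    have h5 := total_le_of_bad hx.1 hj
    have h6 := hI.one_lt_length_last i j
    nlinarith
  -- If `f > 0`, tightness at `λ_i = 0` reads `π + s + z = 0`, so `π = 0`, which leaves no room for
  -- `f`.
  have hgood : ∀ j, I.IsGood j → ∀ k, x.1 (.f i j k) = 0 := by
    intro j hj k
    by_contra hne
    have hpos : 0 < x.1 (.f i j k) := lt_of_le_of_ne (hx.1.1 _) (Ne.symm hne)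
    have h1 := slack_eq_zero hx hpos
    rw [slack_f_good I P R ε x hj, hi] at h1
    have h2 := hx.1.1 (.s i j k)
    have h3 := hx.1.2.2
    have h4 := hπ j
    exact hne (f_eq_zero hx.1 (by linarith) i k)
  -- Since `r_i = R > 0` the budget is tight. It is now a sum of nonnegative terms, so each of them
  -- vanishes.
  have hbud := slack_eq_zero hx (a := .r i) (by rw [hi]; exact hR)
  rw [slack_r] at hbud
  have hterm : ∀ j ∈ Finset.univ, 0 ≤
      I.sgn j * (I.W i j * (P - x.1 (.p j)) - ∑ k, x.1 (.f i j k)) := by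
    intro j _
    by_cases hj : I.IsGood j
    · have := mul_nonneg (hI.endowment_nonneg i j) (hπ j)
      simpa [sgn_of_good hj, hgood j hj] using this
    · simp [hbad j hj, f_eq_zero hx.1 (hbad j hj)]
  have hsum := Finset.sum_nonneg hterm
  have hz := hx.1.2.2
  refine ⟨by linarith, hbad, fun j hj hW => ?_⟩
  have h0 := (Finset.sum_eq_zero_iff_of_nonneg hterm).1 (by linarith) j (Finset.mem_univ j)
  rw [sgn_of_good hj, one_mul] at h0
  simp only [hgood j hj, Finset.sum_const_zero, sub_zero] at h0
  exact (mul_eq_zero.1 h0).resolve_left hW.ne'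

/-- All budgets and all item constraints are tight. Bads then clear and goods have excess supply `(1
+ ε_j) z`, so Walras's law equates `0` with a sum of nonnegative terms containing `|N| z`. -/
theorem z_eq_zero_of_all_pos [Nonempty N] (hI : I.IsSPLC) (hε : ∀ j, 0 < ε j)
    (hx : x ∈ (I.lcp P R ε).solutions) (hr : ∀ i, 0 < x.1 (.r i)) (hp : ∀ j, 0 < x.1 (.p j)) :
    x.2 = 0 := by
  have h := sum_slack_r (P := P) (R := R) (ε := ε) (x := x) hI
  rw [Finset.sum_eq_zero fun i _ => slack_eq_zero hx (hr i)] at h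
  have hz := hx.1.2.2
  have hnn : 0 ≤ ∑ j, I.sgn j * ((P - x.1 (.p j)) - total x.1 j) := by
    refine Finset.sum_nonneg fun j _ => ?_
    have h1 := slack_eq_zero hx (hp j)
    by_cases hj : I.IsGood j
    · rw [slack_p_good I P R ε x hj] at h1
      rw [sgn_of_good hj]
      have := mul_nonneg (hε j).le hz
      linarith
    · rw [slack_p_bad I P R ε x hj] at h1
      rw [h1, mul_zero]
  have hn : (0 : ℝ) < Fintype.card N := by exact_mod_cast Fintype.card_pos
  have h2 : (Fintype.card N : ℝ) * x.2 = 0 := by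
    have := mul_nonneg hn.le hz
    linarith
  exact (mul_eq_zero.1 h2).resolve_left hn.ne'

/-- The points with positive prices and positive inverse bang per buck. -/
def region (I : Market N M) (P R : ℝ) : Set ((I.Var → ℝ) × ℝ) :=
  {x | (∀ j, x.1 (.p j) < P) ∧ ∀ i, x.1 (.r i) < R}

/-- If all constraints that are tight at a point of the region with `z > 0` are tight at `b`,
then `b` lies in the region. -/
theorem mem_region_of_tight [Nonempty N] (hI : I.IsSPLC) (hconn : I.StronglyConnected)
    (hP : 0 < P) (hR : 0 < R) (hε : ∀ j, 0 < ε j) {m b : (I.Var → ℝ) × ℝ}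
    (hm : m ∈ (I.lcp P R ε).solutions) (hmΩ : m ∈ I.region P R) (hmz : 0 < m.2)
    (hb : b ∈ (I.lcp P R ε).solutions) (hbr : ∀ i, b.1 (.r i) ≤ R)
    (ht : ∀ a, m.1 a = 0 → b.1 a = 0)
    (hts : ∀ a, (I.lcp P R ε).slack m a = 0 → (I.lcp P R ε).slack b a = 0) :
    b ∈ I.region P R := by
  have hπb := effective_price_nonneg hI hb.1
  have hpos : ∀ a, 0 < b.1 a → 0 < m.1 a := fun a h =>
    lt_of_le_of_ne (hm.1.1 a) fun h0 => h.ne' (ht a h0.symm)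
  -- `p_j > 0` at `b`, hence at `m`, so at `m` the bad is sold out and someone earns on it. Her
  -- constraint is tight at `m`, hence at `b`, where it reads `D λ + s = 0`.
  have hbad : ∀ j, ¬ I.IsGood j → P - b.1 (.p j) = 0 → ∃ i, b.1 (.r i) = R := by
    intro j hj h0
    have hp : 0 < b.1 (.p j) := by linarith
    have h1 := slack_eq_zero hm (hpos _ hp)
    rw [slack_p_bad I P R ε m hj] at h1
    have h2 : 0 < total m.1 j := by have := hmΩ.1 j; linarith
    obtain ⟨i, -, hi⟩ := Finset.exists_lt_of_sum_lt (s := Finset.univ)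
      (f := fun _ : N => (0 : ℝ)) (by simpa [total] using h2)
    obtain ⟨k, -, hk⟩ := Finset.exists_lt_of_sum_lt (s := Finset.univ)
      (f := fun _ : Fin (I.K i j + 1) => (0 : ℝ)) (by simpa using hi)
    have h3 := hts _ (slack_eq_zero hm hk)
    rw [slack_f_bad I P R ε b hj, h0] at h3
    have h4 := disutility_neg hI hj i k
    have h5 := hb.1.1 (.s i j k)
    have h6 := hbr i
    refine ⟨i, le_antisymm h6 ?_⟩
    nlinarith
  -- Here `z > 0` matters: a good with `p_j > 0` is strictly undersold at `m`.
  have hnot : ∀ j, I.IsGood j → P - b.1 (.p j) = 0 → total m.1 j < P - m.1 (.p j) := by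
    intro j hj h0
    have hp : 0 < b.1 (.p j) := by linarith
    have h1 := slack_eq_zero hm (hpos _ hp)
    rw [slack_p_good I P R ε m hj] at h1
    have : 0 < (1 + ε j) * m.2 := mul_pos (by linarith [hε j]) hmz
    linarith
  have hz : ∀ j, I.IsGood j → P - b.1 (.p j) = 0 → b.2 = 0 := by
    intro j hj h0
    have hp : 0 < b.1 (.p j) := by linarith
    have h1 := slack_eq_zero hb hp
    rw [slack_p_good I P R ε b hj, h0] at h1
    have h2 : 0 ≤ total b.1 j :=
      Finset.sum_nonneg fun _ _ => Finset.sum_nonneg fun _ _ => hb.1.1 _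
    have h3 := hb.1.2.2
    have h4 := hε j
    nlinarith
  -- At `b` the constraint of a segment with `s = 0` reduces to `0 ≤ -U λ`.
  have hlam : ∀ j, I.IsGood j → P - b.1 (.p j) = 0 → ∀ i k, 0 < I.U i j k →
      m.1 (.s i j k) = 0 → b.1 (.r i) = R := by
    intro j hj h0 i k hU hs
    have h1 := hb.1.2.1 (.f i j k)
    rw [slack_f_good I P R ε b hj, h0, hz j hj h0, ht _ hs] at h1
    refine le_antisymm (hbr i) ?_
    nlinarith
  have hsat : ∀ i j k, m.1 (.s i j k) ≠ 0 → m.1 (.f i j k) = I.L i j k * (P - m.1 (.p j)) := by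
    intro i j k hne
    have h1 := slack_eq_zero hm (lt_of_le_of_ne (hm.1.1 (.s i j k)) hne.symm)
    rw [slack_s] at h1
    linarith
  -- If every segment of positive slope were full at `m`, spending would exceed `π_j` by the
  -- assumption on desire.
  have hgood : ∀ j, I.IsGood j → P - b.1 (.p j) = 0 → ∃ i, b.1 (.r i) = R := by
    intro j hj h0
    by_contra hno
    push Not at hno
    have h1 : ∀ i k, 0 < I.U i j k → m.1 (.f i j k) = I.L i j k * (P - m.1 (.p j)) :=
      fun i k hU => hsat i j k fun h => hno i (hlam j hj h0 i k hU h)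
    have h2 : (∑ i, ∑ k with 0 < I.U i j k, I.L i j k) * (P - m.1 (.p j)) ≤ total m.1 j := by
      rw [Finset.sum_mul]
      refine Finset.sum_le_sum fun i _ => ?_
      rw [Finset.sum_mul]
      refine (Finset.sum_congr rfl fun k hk => (h1 i k (Finset.mem_filter.1 hk).2).symm).le.trans ?_
      exact Finset.sum_le_sum_of_subset_of_nonneg (Finset.filter_subset _ _) fun _ _ _ => hm.1.1 _
    have h3 := hI.desire j hj
    have h4 := hnot j hj h0
    have h5 := hmΩ.1 j
    nlinarith
  -- The last segment is longer than `1`, so it cannot be full at `m` and `s = 0` there.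
  have hnonsat : ∀ j, I.IsGood j → P - b.1 (.p j) = 0 → ∀ i, I.NonSatiated i j →
      b.1 (.r i) = R := by
    intro j hj h0 i hi
    refine hlam j hj h0 i _ hi ?_
    by_contra hne
    have h1 := hsat i j _ hne
    have h2 := f_le_total hm.1.1 i j (Fin.last _)
    have h3 := hnot j hj h0
    have h4 := hI.one_lt_length_last i j
    have h5 := hmΩ.1 j
    nlinarith
  suffices hno : ∀ i, b.1 (.r i) ≠ R by
    refine ⟨fun j => ?_, fun i => lt_of_le_of_ne (hbr i) (hno i)⟩
    by_contra hj
    have h0 : P - b.1 (.p j) = 0 := by have := hπb j; linarith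
    by_cases hg : I.IsGood j
    · obtain ⟨i, hi⟩ := hgood j hg h0; exact hno i hi
    · obtain ⟨i, hi⟩ := hbad j hg h0; exact hno i hi
  intro i₀ hi₀
  -- Travel backwards along the economy graph: the owner's `λ = 0` makes her goods free, and free
  -- goods force `λ = 0` for all who are non-satiated for them.
  have hall : ∀ i, b.1 (.r i) = R := by
    intro i
    refine Relation.ReflTransGen.head_induction_on (hconn.economy i i₀) hi₀ ?_
    rintro a c ⟨j, hj, hns, hW⟩ - hc
    exact hnonsat j hj ((of_r_eq hI hR hb hc).2.2 j hj hW) a hns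
  have hp : ∀ j, P - b.1 (.p j) = 0 := by
    intro j
    by_cases hj : I.IsGood j
    · obtain ⟨i, -, hi⟩ := Finset.exists_lt_of_sum_lt (s := Finset.univ)
        (f := fun _ : N => (0 : ℝ)) (g := fun i => I.W i j) (by simp [hI.supply j])
      exact (of_r_eq hI hR hb (hall i)).2.2 j hj hi
    · exact (of_r_eq hI hR hb hi₀).2.1 j hj
  refine hmz.ne' (z_eq_zero_of_all_pos hI hε hm (fun i => hpos _ ?_) fun j => hpos _ ?_)
  · rw [hall i]; exact hR
  · linarith [hp j]

theorem exists_first_exit (a b c : ℝ) (ha : a < c) (hb : c < a + b) :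
    ∃ t, 0 < t ∧ t < 1 ∧ a + t * b = c := by
  have hb0 : 0 < b := by linarith
  refine ⟨(c - a) / b, by apply div_pos <;> linarith, ?_, by field_simp; ring⟩
  rw [div_lt_one hb0]
  linarith

/-- A segment of solutions does not leave the region. -/
theorem region_closed [Nonempty N] (hI : I.IsSPLC) (hconn : I.StronglyConnected)
    (hP : 0 < P) (hR : 0 < R) (hε : ∀ j, 0 < ε j) {x x' : (I.Var → ℝ) × ℝ}
    (hx : x ∈ I.region P R) (hz : 0 < x.2)
    (hseg : segment ℝ x x' ⊆ (I.lcp P R ε).solutions) : x' ∈ I.region P R := by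
  by_contra hx'
  let y : ℝ → (I.Var → ℝ) × ℝ := fun t => x + t • (x' - x)
  have hy : ∀ t ∈ Set.Icc (0 : ℝ) 1, y t ∈ (I.lcp P R ε).solutions := fun t ht => by
    refine hseg ?_
    rw [segment_eq_image']
    exact ⟨t, ht, rfl⟩
  let B : Set ℝ := Set.Icc 0 1 ∩ {t | y t ∉ I.region P R}
  have hcl : IsClosed {t | y t ∉ I.region P R} := by
    have : {t | y t ∉ I.region P R} = (⋃ j, {t | P ≤ x.1 (.p j) + t * (x'.1 (.p j) - x.1 (.p j))}) ∪
        ⋃ i, {t | R ≤ x.1 (.r i) + t * (x'.1 (.r i) - x.1 (.r i))} := by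
      ext t
      simp [y, region, -not_and, not_and_or]
    rw [this]
    exact (isClosed_iUnion_of_finite fun j => isClosed_le continuous_const (by fun_prop)).union
      (isClosed_iUnion_of_finite fun j => isClosed_le continuous_const (by fun_prop))
  have hB : IsCompact B := isCompact_Icc.inter_right hcl
  have hBne : B.Nonempty := ⟨1, ⟨zero_le_one, le_rfl⟩, by simpa [y] using hx'⟩
  -- `τ` is the first time outside the region. What is tight at the inner point `y (τ / 2)` is tight
  -- at `y τ`, and `r_i ≤ R` at `y τ` because `r_i` would otherwise reach `R` earlier.
  obtain ⟨τ, ⟨⟨hτ0, hτ1⟩, hτ⟩, hleast⟩ := hB.exists_isLeast hBne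
  have hτne : τ ≠ 0 := by rintro rfl; exact hτ (by simpa [y] using hx)
  have hτpos : 0 < τ := lt_of_le_of_ne hτ0 hτne.symm
  have hbefore : ∀ t, 0 ≤ t → t < τ → y t ∈ I.region P R := by
    intro t h0 h1
    by_contra h
    exact absurd (hleast ⟨⟨h0, by linarith⟩, h⟩) (not_le.2 h1)
  have hmid : y (τ / 2) ∈ openSegment ℝ x (y τ) :=
    ⟨1 / 2, 1 / 2, by norm_num, by norm_num, by norm_num, by simp only [y]; module⟩
  have hxs : x ∈ (I.lcp P R ε).polyhedron := (hseg (left_mem_segment ℝ x x')).1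
  have hys := hy τ ⟨hτ0, hτ1⟩
  refine hτ (mem_region_of_tight hI hconn hP hR hε (hy (τ / 2) ⟨by linarith, by linarith⟩)
    (hbefore (τ / 2) (by linarith) (by linarith)) ?_ hys (fun i => ?_) (fun a h => ?_)
    fun a h => ?_)
  · have h1 := hys.1.2.2
    have h2 : (y (τ / 2)).2 = (x.2 + (y τ).2) / 2 := by
      simp only [y, Prod.snd_add, Prod.smul_snd, smul_eq_mul, Prod.snd_sub]; ring
    rw [h2]; linarith
  · by_contra hlt
    push Not at hlt
    obtain ⟨t, ht0, ht1, ht⟩ := exists_first_exit (x.1 (.r i)) (τ * (x'.1 (.r i) - x.1 (.r i))) R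
      (hx.2 i) hlt
    have := (hbefore (t * τ) (by positivity) (by nlinarith)).2 i
    have h2 : (y (t * τ)).1 (.r i) = x.1 (.r i) + t * (τ * (x'.1 (.r i) - x.1 (.r i))) := by
      simp [y]; ring
    rw [h2, ht] at this
    exact lt_irrefl _ this
  · exact ((I.lcp P R ε).constraintValue_eq_zero_of_openSegment hxs hys.1 hmid
      (κ := Sum.inl a) h).2
  · exact ((I.lcp P R ε).constraintValue_eq_zero_of_openSegment hxs hys.1 hmid
      (κ := Sum.inr a) h).2

theorem direction_nonneg {a d : ℝ} (h0 : ∀ α : ℝ, 0 ≤ α → 0 ≤ a + α * d) : 0 ≤ d := by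
  by_contra hd
  push Not at hd
  have ha : 0 ≤ a := by simpa using h0 0 le_rfl
  -- At this parameter the value is `a - (a + 1) = -1`.
  have := h0 ((a + 1) / -d) (div_nonneg (by linarith) (by linarith))
  have h3 : (a + 1) / -d * d = -(a + 1) := by
    rw [div_mul_eq_mul_div, div_eq_iff (by linarith)]; ring
  rw [h3] at this; linarith

theorem eq_zero_of_bounded {a d c : ℝ} (h0 : ∀ α : ℝ, 0 ≤ α → 0 ≤ a + α * d)
    (h1 : ∀ α : ℝ, 0 ≤ α → a + α * d ≤ c) : d = 0 :=
  le_antisymm (neg_nonneg.1 (direction_nonneg (a := c - a) fun α hα => by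
    linarith [h1 α hα])) (direction_nonneg h0)

/-- All half-lines of solutions in the region are parts of the primary ray. -/
theorem region_ray [Nonempty N] (hI : I.IsSPLC) (hconn : I.StronglyConnected)
    (hP : 0 < P) (hR : 0 < R) (hε : ∀ j, 0 < ε j)
    (hRbad : ∀ i j k, ¬ I.IsGood j → P < -I.U i j k * R)
    {x d : (I.Var → ℝ) × ℝ} (hx : x ∈ I.region P R) (hz : 0 < x.2) (hd : d ≠ 0)
    (hray : ∀ α : ℝ, 0 ≤ α → x + α • d ∈ (I.lcp P R ε).solutions) : x.1 = 0 ∧ d.1 = 0 := by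
  have hΩ : ∀ α : ℝ, 0 ≤ α → x + α • d ∈ I.region P R := by
    intro α hα
    refine region_closed hI hconn hP hR hε hx hz fun y hy => ?_
    rw [segment_eq_image'] at hy
    obtain ⟨t, ht, rfl⟩ := hy
    simp only [add_sub_cancel_left, smul_smul]
    exact hray _ (mul_nonneg ht.1 hα)
  have hnn : ∀ a, ∀ α : ℝ, 0 ≤ α → 0 ≤ x.1 a + α * d.1 a := fun a α hα => (hray α hα).1.1 a
  -- The region bounds `p` and `r`, and `f ≤ L π` bounds `f`; only `s` and `z` can grow.
  have hdp : ∀ j, d.1 (.p j) = 0 := fun j =>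
    eq_zero_of_bounded (hnn _) fun α hα => ((hΩ α hα).1 j).le
  have hdr : ∀ i, d.1 (.r i) = 0 := fun i =>
    eq_zero_of_bounded (hnn _) fun α hα => ((hΩ α hα).2 i).le
  have hdf : ∀ i j k, d.1 (.f i j k) = 0 := fun i j k =>
    eq_zero_of_bounded (c := I.L i j k * (P - x.1 (.p j))) (hnn _) fun α hα => by
      have := f_le (hray α hα).1 i j k
      simpa [hdp j] using this
  have hds : ∀ i j k, 0 ≤ d.1 (.s i j k) := fun i j k => direction_nonneg (hnn _)
  have hdz : 0 ≤ d.2 := direction_nonneg (a := x.2) fun α hα => (hray α hα).1.2.2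
  have hx0 : x ∈ (I.lcp P R ε).solutions := by simpa using hray 0 le_rfl
  have h1s := hray 1 zero_le_one
  have h2s := hray 2 zero_le_two
  rw [one_smul] at h1s
  have h1p : ∀ j, (x + d).1 (.p j) = x.1 (.p j) := fun j => by simp [hdp j]
  have h1f : ∀ i j k, (x + d).1 (.f i j k) = x.1 (.f i j k) := fun i j k => by simp [hdf i j k]
  have h1r : ∀ i, (x + d).1 (.r i) = x.1 (.r i) := fun i => by simp [hdr i]
  have h1t : ∀ j, total (x + d).1 j = total x.1 j := fun j => by simp only [total, h1f]
  have hpos : ∀ a, 0 < (x + d).1 a → (I.lcp P R ε).slack (x + d) a = 0 := fun a h =>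
    slack_eq_zero h1s h
  -- If only `s` grew, `s > 0` would give `f = L π > 0`, and then the constraint of `f` would be
  -- tight at `x` and at `x + d` although only `s` changes in it.
  have hdzpos : 0 < d.2 := by
    refine lt_of_le_of_ne hdz fun hdz0 => hd (Prod.ext (funext fun a => ?_) hdz0.symm)
    cases a with
    | r i => exact hdr i
    | p j => exact hdp j
    | f i j k => exact hdf i j k
    | s i j k =>
      by_contra hne
      have hsp : 0 < d.1 (.s i j k) := lt_of_le_of_ne (hds i j k) (Ne.symm hne)
      have h3 : 0 < (x + d).1 (.s i j k) := by
        have := hx0.1.1 (.s i j k)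
        simp only [Prod.fst_add, Pi.add_apply]; linarith
      have h4 := hpos _ h3
      rw [slack_s, h1p, h1f] at h4
      have h5 : 0 < x.1 (.f i j k) := by
        have := mul_pos (hI.length_pos i j k) (sub_pos.2 (hx.1 j))
        linarith
      have h6 := slack_eq_zero hx0 h5
      have h7 := hpos (.f i j k) (by rw [h1f]; exact h5)
      by_cases hj : I.IsGood j
      · rw [slack_f_good I P R ε _ hj] at h6 h7
        rw [h1p, h1r] at h7
        simp only [Prod.fst_add, Pi.add_apply, Prod.snd_add, ← hdz0] at h7
        linarith
      · rw [slack_f_bad I P R ε _ hj] at h6 h7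
        rw [h1p, h1r] at h7
        simp only [Prod.fst_add, Pi.add_apply] at h7
        linarith
  -- As `z` grows, every constraint containing `z` becomes slack, so its complementary variable is
  -- zero. For bads and for `s`, slackness comes from `hRbad`, from `total = 0 < π`, and from `f = 0
  -- < L P`.
  have hr0 : ∀ i, x.1 (.r i) = 0 := by
    intro i
    by_contra hne
    have h4 := hpos (.r i) (by rw [h1r]; exact lt_of_le_of_ne (hx0.1.1 _) (Ne.symm hne))
    have h5 := hx0.1.2.1 (.r i)
    rw [slack_r] at h4 h5
    simp only [h1p, h1f, Prod.snd_add] at h4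
    linarith
  have hf0 : ∀ i j k, x.1 (.f i j k) = 0 := by
    intro i j k
    by_contra hne
    have h4 := hpos (.f i j k) (by rw [h1f]; exact lt_of_le_of_ne (hx0.1.1 _) (Ne.symm hne))
    have h5 := hx0.1.2.1 (.f i j k)
    have h6 := hds i j k
    by_cases hj : I.IsGood j
    · rw [slack_f_good I P R ε _ hj] at h4 h5
      rw [h1p, h1r] at h4
      simp only [Prod.fst_add, Pi.add_apply, Prod.snd_add] at h4
      linarith
    · rw [slack_f_bad I P R ε _ hj, h1p, h1r, hr0] at h4
      have h7 := hRbad i j k hj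
      have h8 := hx0.1.1 (.p j)
      have h9 := h1s.1.1 (.s i j k)
      linarith
  have hp0 : ∀ j, x.1 (.p j) = 0 := by
    intro j
    by_contra hne
    have h4 := hpos (.p j) (by rw [h1p]; exact lt_of_le_of_ne (hx0.1.1 _) (Ne.symm hne))
    have h5 := hx0.1.2.1 (.p j)
    by_cases hj : I.IsGood j
    · rw [slack_p_good I P R ε _ hj] at h4 h5
      rw [h1p, h1t] at h4
      simp only [Prod.snd_add] at h4
      have := mul_pos (by linarith [hε j] : 0 < 1 + ε j) hdzpos
      linarith
    · rw [slack_p_bad I P R ε _ hj, h1p, h1t] at h4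
      have h6 : total x.1 j = 0 := by simp [total, hf0]
      have := hx.1 j
      linarith
  have hs0 : ∀ i j k, (x + d).1 (.s i j k) = 0 := by
    intro i j k
    by_contra hne
    have h4 := hpos (.s i j k) (lt_of_le_of_ne (h1s.1.1 _) (Ne.symm hne))
    rw [slack_s, h1p, h1f, hf0, hp0] at h4
    have := mul_pos (hI.length_pos i j k) hP
    linarith
  have hsd : ∀ i j k, x.1 (.s i j k) = 0 ∧ d.1 (.s i j k) = 0 := by
    intro i j k
    have h1 := hs0 i j k
    have h2 := hx0.1.1 (.s i j k)
    have h3 := hds i j k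
    simp only [Prod.fst_add, Pi.add_apply] at h1
    constructor <;> linarith
  constructor
  · funext a
    cases a with
    | r i => exact hr0 i
    | p j => exact hp0 j
    | f i j k => exact hf0 i j k
    | s i j k => exact (hsd i j k).1
  · funext a
    cases a with
    | r i => exact hdr i
    | p j => exact hdp j
    | f i j k => exact hdf i j k
    | s i j k => exact (hsd i j k).2

/-! ## The primary ray -/

/-- The slopes of the goods. -/
def goodSlopes (I : Market N M) : Set ℝ := {u | ∃ i j k, I.IsGood j ∧ u = I.U i j k}

theorem finite_goodSlopes (I : Market N M) : I.goodSlopes.Finite := by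
  refine (Set.finite_range fun e : Σ i : N, Σ j : M, Fin (I.K i j + 1) =>
    I.U e.1 e.2.1 e.2.2).subset ?_
  rintro u ⟨i, j, k, -, rfl⟩
  exact ⟨⟨i, j, k⟩, rfl⟩

theorem le_maxSlope (i : N) {j : M} (hj : I.IsGood j) (k : Fin (I.K i j + 1)) :
    I.U i j k ≤ sSup I.goodSlopes :=
  le_csSup (finite_goodSlopes I).bddAbove ⟨i, j, k, hj, rfl⟩

theorem exists_maxSlope [Nonempty N] (hconn : I.StronglyConnected) :
    ∃ i j k, I.IsGood j ∧ sSup I.goodSlopes = I.U i j k := by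
  obtain ⟨j, hj, -⟩ := hconn.brings_good (Classical.arbitrary N)
  exact Set.Nonempty.csSup_mem (s := I.goodSlopes)
    ⟨_, Classical.arbitrary N, j, 0, hj, rfl⟩ (finite_goodSlopes I)

theorem maxSlope_pos [Nonempty N] (hconn : I.StronglyConnected) : 0 < sSup I.goodSlopes := by
  obtain ⟨j, ⟨i, hi⟩, -⟩ := hconn.brings_good (Classical.arbitrary N)
  exact hi.trans_le (le_maxSlope i ⟨i, hi⟩ 0)

theorem startZ_eq (I : Market N M) (P R : ℝ) : I.startZ P R = sSup I.goodSlopes * R - P := rfl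

theorem start_sol [Nonempty N] (hI : I.IsSPLC) (hconn : I.StronglyConnected)
    (hP : 0 < P) (hR : 0 < R) (hε : ∀ j, 0 < ε j)
    (hRbad : ∀ i j k, ¬ I.IsGood j → P < -I.U i j k * R)
    (hRstart : P * (Fintype.card M + 1) ≤ I.startZ P R) (z : ℝ) :
    ((0 : I.Var → ℝ), z) ∈ (I.lcp P R ε).solutions ↔ I.startZ P R ≤ z := by
  constructor
  · intro h
    obtain ⟨i, j, k, hj, hU⟩ := exists_maxSlope hconn
    have h1 := h.1.2.1 (.f i j k)
    rw [slack_f_good I P R ε _ hj] at h1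
    rw [startZ_eq, hU]
    simp only [Pi.zero_apply] at h1
    linarith
  · intro h
    have hz := hRstart.trans h
    have hm : (0 : ℝ) ≤ Fintype.card M := Nat.cast_nonneg _
    have hPz : P ≤ z := by nlinarith
    refine AugLCP.mem_solutions_of_fst_eq_zero _ ⟨fun _ => le_rfl, fun a => ?_, by linarith⟩ rfl
    cases a with
    | r i =>
      rw [slack_r]
      simp only [Pi.zero_apply, Finset.sum_const_zero, sub_zero]
      -- At `y = 0` an item changes a budget by at least `-P`; the margin in `hRstart` absorbs all
      -- of them.
      have h1 : ∀ j ∈ Finset.univ, -P ≤ I.sgn j * (I.W i j * P) := by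
        intro j _
        have h0 := hI.endowment_nonneg i j
        have h2 : I.W i j ≤ 1 := by
          rw [← hI.supply j]
          exact Finset.single_le_sum (f := fun i => I.W i j)
            (fun i _ => hI.endowment_nonneg i j) (Finset.mem_univ i)
        by_cases hj : I.IsGood j
        · rw [sgn_of_good hj]; nlinarith
        · rw [sgn_of_bad hj]; nlinarith
      have h2 := Finset.sum_le_sum h1
      simp only [Finset.sum_const, Finset.card_univ, nsmul_eq_mul] at h2
      nlinarith
    | p j =>
      have ht : total (0 : I.Var → ℝ) j = 0 := by simp [total]
      by_cases hj : I.IsGood j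
      · rw [slack_p_good I P R ε _ hj, ht]
        simp only [Pi.zero_apply, sub_zero]
        have := mul_nonneg (hε j).le (hP.le.trans hPz)
        linarith
      · rw [slack_p_bad I P R ε _ hj, ht]
        simpa using hP.le
    | f i j k =>
      by_cases hj : I.IsGood j
      · rw [slack_f_good I P R ε _ hj]
        rw [startZ_eq] at h
        have := mul_le_mul_of_nonneg_right (le_maxSlope i hj k) hR.le
        simp only [Pi.zero_apply]
        linarith
      · rw [slack_f_bad I P R ε _ hj]
        have := hRbad i j k hj
        simp only [Pi.zero_apply]
        linarith
    | s i j k =>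
      rw [slack_s]
      have := mul_pos (hI.length_pos i j k) hP
      simp only [Pi.zero_apply]
      linarith

theorem regular [Nonempty N] (hI : I.IsSPLC) (hconn : I.StronglyConnected)
    (hP : 0 < P) (hR : 0 < R) (hε : ∀ j, 0 < ε j)
    (hRbad : ∀ i j k, ¬ I.IsGood j → P < -I.U i j k * R)
    (hRstart : P * (Fintype.card M + 1) ≤ I.startZ P R)
    (hnd : ∀ x ∈ (I.lcp P R ε).solutions, x ∈ I.region P R → 0 < x.2 → ∀ k k',
      (I.lcp P R ε).IsDoubleLabel x k → (I.lcp P R ε).IsDoubleLabel x k' → k = k') :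
    (I.lcp P R ε).Regular (I.region P R) (I.startZ P R) where
  nondegenerate := hnd
  closed _ _ hx hz h := region_closed hI hconn hP hR hε hx hz h
  ray _ _ hx hz hd h := region_ray hI hconn hP hR hε hRbad hx hz hd h
  start_pos := lt_of_lt_of_le (by positivity) hRstart
  start_mem := ⟨fun _ => hP, fun _ => hR⟩
  start_sol := start_sol hI hconn hP hR hε hRbad hRstart
  start_label := by
    obtain ⟨i, j, k, hj, hU⟩ := exists_maxSlope hconn
    refine ⟨.f i j k, ?_, ?_⟩
    · rw [slack_f_good I P R ε _ hj, startZ_eq, hU]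
      simp
    · simp [lcp, hj]

end Market

/-! # Linear independence and generic rank -/

/-- Over the reals `w v vᵀ = 0` gives `|w v|² = 0`. This turns independence into the nonvanishing of
a single polynomial in the entries. -/
theorem linearIndependent_iff_gram_det_ne_zero {m n : Type*} [Fintype m] [DecidableEq m]
    [Fintype n] (v : Matrix m n ℝ) : LinearIndependent ℝ v.row ↔ (v * v.transpose).det ≠ 0 := by
  rw [← Matrix.vecMul_injective_iff, ← not_iff_not, not_not, ← Matrix.exists_vecMul_eq_zero_iff]
  have hker : ∀ w, Matrix.vecMul w (v * v.transpose) = 0 ↔ Matrix.vecMul w v = 0 := by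
    intro w
    constructor
    · intro h
      rw [← Matrix.vecMul_vecMul] at h
      have h2 : dotProduct (Matrix.vecMul (Matrix.vecMul w v) v.transpose) w = 0 := by
        rw [h, zero_dotProduct]
      rw [Matrix.vecMul_transpose, dotProduct_comm, Matrix.dotProduct_mulVec] at h2
      exact dotProduct_self_eq_zero.1 h2
    · intro h
      rw [← Matrix.vecMul_vecMul, h, Matrix.zero_vecMul]
  constructor
  · intro h
    by_contra hno
    push Not at hno
    refine h fun a b hab => ?_
    by_contra hne
    refine hno (a - b) (sub_ne_zero.2 hne) ((hker _).2 ?_)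
    rw [Matrix.sub_vecMul]
    exact sub_eq_zero.2 hab
  · rintro ⟨w, hw, h⟩ hinj
    exact hw (hinj (((hker w).1 h).trans (Matrix.zero_vecMul v).symm))

/-- If the rank of the family `a + t b` is maximal at `t = 0`, then `b` maps relations of `a` to
the span of `a`. -/
theorem sum_smul_derivative_mem_ker {m V : Type*} [Fintype m] [NormedAddCommGroup V]
    [NormedSpace ℝ V] [FiniteDimensional ℝ V] (a b : m → V) (w : m → ℝ) (ξ : V →ₗ[ℝ] ℝ)
    (hrank : ∀ t : ℝ, Module.finrank ℝ (Submodule.span ℝ (Set.range fun κ => a κ + t • b κ)) ≤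
      Module.finrank ℝ (Submodule.span ℝ (Set.range a)))
    (hw : ∑ κ, w κ • a κ = 0) (hξ : ∀ κ, ξ (a κ) = 0) : ξ (∑ κ, w κ • b κ) = 0 := by
  by_contra hne
  set c := ∑ κ, w κ • b κ with hc
  obtain ⟨f, hf, hspan, hli⟩ := Submodule.exists_fun_fin_finrank_span_eq ℝ (Set.range a)
  choose e he using hf
  have hker : Submodule.span ℝ (Set.range a) ≤ LinearMap.ker ξ := by
    rw [Submodule.span_le]
    rintro _ ⟨κ, rfl⟩
    exact hξ κ
  have hcons : LinearIndependent ℝ (Fin.cons c f : Fin _ → V) := by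
    rw [linearIndependent_finCons]
    refine ⟨hli, fun h => hne ?_⟩
    rw [hspan] at h
    exact hker h
  -- At `t = 0` this is a basis of the span of `a` together with `c`, which is outside because `ξ c
  -- ≠ 0`. Independence persists for small `t`.
  let g : ℝ → Fin (Module.finrank ℝ (Submodule.span ℝ (Set.range a)) + 1) → V :=
    fun t => Fin.cons c fun i => a (e i) + t • b (e i)
  have hg : Continuous g := by
    refine continuous_pi fun i => ?_
    refine Fin.cases ?_ (fun i => ?_) i
    · exact continuous_const
    · simp only [g, Fin.cons_succ]; fun_prop
  have hg0 : g 0 = Fin.cons c f := by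
    simp only [g, zero_smul, add_zero, he]
  have hopen := (isOpen_setOfPred_linearIndependent (𝕜 := ℝ) (E := V)
    (ι := Fin (Module.finrank ℝ (Submodule.span ℝ (Set.range a)) + 1))).preimage hg
  have hev : ∀ᶠ t in nhds (0 : ℝ), LinearIndependent ℝ (g t) :=
    hopen.mem_nhds (by
      show LinearIndependent ℝ (g 0)
      rw [hg0]; exact hcons)
  have hev' : ∀ᶠ t in nhdsWithin (0 : ℝ) (Set.Ioi 0), LinearIndependent ℝ (g t) :=
    hev.filter_mono nhdsWithin_le_nhds
  obtain ⟨t, ht, ht0⟩ := (hev'.and self_mem_nhdsWithin).exists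
  have ht0 : (0 : ℝ) < t := ht0
  have hsub : ∀ i, g t i ∈ Submodule.span ℝ (Set.range fun κ => a κ + t • b κ) := by
    refine Fin.cases ?_ fun i => ?_
    -- As `w` annihilates `a`, the vector `c` belongs to the span of the moved family, whose rank is
    -- therefore too large.
    · have h1 : c = t⁻¹ • ∑ κ, w κ • (a κ + t • b κ) := by
        simp only [smul_add, Finset.sum_add_distrib, hw, zero_add]
        simp only [smul_comm _ t, ← Finset.smul_sum, ← hc]
        rw [smul_smul, mul_inv_cancel₀ ht0.ne', one_smul]
      show c ∈ _
      rw [h1]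
      exact Submodule.smul_mem _ _ (Submodule.sum_mem _ fun κ _ => Submodule.smul_mem _ _
        (Submodule.subset_span ⟨κ, rfl⟩))
    · exact Submodule.subset_span ⟨e i, rfl⟩
  have h1 : Module.finrank ℝ (Submodule.span ℝ (Set.range a)) + 1 ≤
      Module.finrank ℝ (Submodule.span ℝ (Set.range fun κ => a κ + t • b κ)) := by
    have h2 := finrank_span_eq_card ht
    rw [Fintype.card_fin] at h2
    rw [← h2]
    refine Submodule.finrank_mono (Submodule.span_le.2 ?_)
    rintro _ ⟨i, rfl⟩
    exact hsub i
  have := hrank t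
  omega

namespace Market

variable {N M : Type*} [Fintype N] [Fintype M] (I : Market N M)

/-! ## The rows of the complementarity problem over an arbitrary ring -/

open Classical in
/-- `1` for goods and `0` for bads. -/
noncomputable def goodInt (j : M) : ℤ := if I.IsGood j then 1 else 0

open Classical in
/-- `1` for goods and `-1` for bads. -/
noncomputable def sgnInt (j : M) : ℤ := if I.IsGood j then 1 else -1

/-- The columns: `none` for the constant `P`, `some none` for `z`, and the variables. -/
abbrev Col := Option (Option I.Var)

section Row

variable {A : Type*} [CommRing A]

/-- The constraints as linear forms, where `ρ = R / P`; the terms `δ_j z` are left out. -/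
noncomputable def row (θ : I.Param → A) (ρ : A) : I.Var ⊕ I.Var → (I.Col → A) →ₗ[A] A
  | .inl a => LinearMap.proj (some (some a))
  | .inr (.r i) =>
    { toFun := fun v => ∑ j, (I.sgnInt j : A) * (θ (.W i j) * (v none - v (some (some (.p j)))) -
        ∑ k, v (some (some (.f i j k)))) + v (some none)
      map_add' := fun u v => by
        simp only [Pi.add_apply, Finset.sum_add_distrib]
        rw [show ∀ a b c d : A, a + b + (c + d) = (a + c) + (b + d) by intros; ring,
          ← Finset.sum_add_distrib]
        congr 1
        exact Finset.sum_congr rfl fun j _ => by ring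
      map_smul' := fun c v => by
        simp only [Pi.smul_apply, smul_eq_mul, RingHom.id_apply, ← Finset.mul_sum]
        rw [mul_add, Finset.mul_sum]
        congr 1
        exact Finset.sum_congr rfl fun j _ => by ring }
  | .inr (.p j) =>
    { toFun := fun v => (I.sgnInt j : A) * (∑ i, ∑ k, v (some (some (.f i j k))) -
        (v none - v (some (some (.p j)))))
      map_add' := fun u v => by
        simp only [Pi.add_apply, Finset.sum_add_distrib]; ring
      map_smul' := fun c v => by
        simp only [Pi.smul_apply, smul_eq_mul, RingHom.id_apply, ← Finset.mul_sum]; ring }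
  | .inr (.f i j k) =>
    { toFun := fun v => (I.sgnInt j : A) * (v none - v (some (some (.p j)))) -
        θ (.U i j k) * (ρ * v none - v (some (some (.r i)))) + v (some (some (.s i j k))) +
        (I.goodInt j : A) * v (some none)
      map_add' := fun u v => by simp only [Pi.add_apply]; ring
      map_smul' := fun c v => by
        simp only [Pi.smul_apply, smul_eq_mul, RingHom.id_apply]; ring }
  | .inr (.s i j k) =>
    { toFun := fun v => θ (.L i j k) * (v none - v (some (some (.p j)))) -
        v (some (some (.f i j k)))
      map_add' := fun u v => by simp only [Pi.add_apply]; ring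
      map_smul' := fun c v => by
        simp only [Pi.smul_apply, smul_eq_mul, RingHom.id_apply]; ring }

variable (θ : I.Param → A) (ρ : A) (v : I.Col → A)

theorem row_inl (a : I.Var) : I.row θ ρ (.inl a) v = v (some (some a)) := rfl

theorem row_r (i : N) : I.row θ ρ (.inr (.r i)) v =
    ∑ j, (I.sgnInt j : A) * (θ (.W i j) * (v none - v (some (some (.p j)))) -
        ∑ k, v (some (some (.f i j k)))) + v (some none) := rfl

theorem row_p (j : M) : I.row θ ρ (.inr (.p j)) v =
    (I.sgnInt j : A) * (∑ i, ∑ k, v (some (some (.f i j k))) -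
        (v none - v (some (some (.p j))))) := rfl

theorem row_f (i : N) (j : M) (k : Fin (I.K i j + 1)) : I.row θ ρ (.inr (.f i j k)) v =
    (I.sgnInt j : A) * (v none - v (some (some (.p j)))) -
        θ (.U i j k) * (ρ * v none - v (some (some (.r i)))) + v (some (some (.s i j k))) +
        (I.goodInt j : A) * v (some none) := rfl

theorem row_s (i : N) (j : M) (k : Fin (I.K i j + 1)) : I.row θ ρ (.inr (.s i j k)) v =
    θ (.L i j k) * (v none - v (some (some (.p j)))) - v (some (some (.f i j k))) := rfl

/-- Allows rows with indeterminate entries to be specialised to real data. -/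
theorem map_row {B : Type*} [CommRing B] (φ : A →+* B) (κ : I.Var ⊕ I.Var) :
    φ (I.row θ ρ κ v) = I.row (fun a => φ (θ a)) (φ ρ) κ fun c => φ (v c) := by
  rcases κ with a | (i | j | ⟨i, j, k⟩ | ⟨i, j, k⟩)
  · rfl
  · simp [row_r]
  · simp [row_p]
  · simp [row_f]
  · simp [row_s]

open Classical in
/-- The coefficients of a row. -/
noncomputable def rowVec (κ : I.Var ⊕ I.Var) (c : I.Col) : A := I.row θ ρ κ (Pi.single c 1)

theorem map_rowVec {B : Type*} [CommRing B] (φ : A →+* B) (κ : I.Var ⊕ I.Var) (c : I.Col) :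
    φ (I.rowVec θ ρ κ c) = I.rowVec (fun a => φ (θ a)) (φ ρ) κ c := by
  classical
  rw [rowVec, map_row, rowVec]
  congr 1
  funext c'
  by_cases h : c' = c
  · subst h; simp
  · simp [h]

theorem row_eq_sum (κ : I.Var ⊕ I.Var) :
    I.row θ ρ κ v = ∑ c, v c * I.rowVec θ ρ κ c := by
  classical
  rw [LinearMap.pi_apply_eq_sum_univ (I.row θ ρ κ) v]
  refine Finset.sum_congr rfl fun c _ => ?_
  rw [smul_eq_mul, rowVec]
  congr 2
  funext c'
  rw [Pi.single_apply]
  simp only [eq_comm]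

theorem row_add_smul (κ : I.Var ⊕ I.Var) (dθ : I.Param → A) (t : A) :
    I.row (θ + t • dθ) ρ κ v =
      I.row θ ρ κ v + t * (I.row (θ + dθ) ρ κ v - I.row θ ρ κ v) := by
  rcases κ with a | (i | j | ⟨i, j, k⟩ | ⟨i, j, k⟩)
  · simp [row_inl]
  · simp only [row_r, Pi.add_apply, Pi.smul_apply, smul_eq_mul, add_sub_add_right_eq_sub]
    rw [← Finset.sum_sub_distrib, Finset.mul_sum, add_right_comm, ← Finset.sum_add_distrib]
    congr 1
    exact Finset.sum_congr rfl fun j _ => by ring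
  · simp [row_p]
  · simp only [row_f, Pi.add_apply, Pi.smul_apply, smul_eq_mul]; ring
  · simp only [row_s, Pi.add_apply, Pi.smul_apply, smul_eq_mul]; ring

end Row

/-! ## Generic rank -/

/-- For large `ρ`, the rows that are linearly independent at some variation of the parameters are
linearly independent at the parameters themselves. -/
theorem exists_forall_linearIndependent {I : Market N M} (hgen : I.NoPolynomialRelation) :
    ∃ ρ₀ : ℝ, ∀ ρ, ρ₀ < ρ → ∀ (n : ℕ) (e : Fin n → I.Var ⊕ I.Var) (θ : I.Param → ℝ) (ρ' : ℝ),
      I.IsVariation θ → LinearIndependent ℝ (fun i => I.rowVec θ ρ' (e i)) →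
      LinearIndependent ℝ (fun i => I.rowVec I.paramValue ρ (e i)) := by
  classical
  let A := Polynomial (MvPolynomial I.Param ℚ)
  let mat : (n : ℕ) → (Fin n → I.Var ⊕ I.Var) → Matrix (Fin n) I.Col A := fun n e =>
    Matrix.of fun i => I.rowVec (fun a => Polynomial.C (MvPolynomial.X a)) Polynomial.X (e i)
  -- The Gram determinant, as a polynomial in `ρ` whose coefficients are rational polynomials in the
  -- data.
  let F : (n : ℕ) → (Fin n → I.Var ⊕ I.Var) → A := fun n e =>
    (mat n e * (mat n e).transpose).det
  let ev : (I.Param → ℝ) → MvPolynomial I.Param ℚ →+* ℝ := fun θ =>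
    (MvPolynomial.aeval θ).toRingHom
  have hF : ∀ n e θ ρ, Polynomial.eval₂ (ev θ) ρ (F n e) ≠ 0 ↔
      LinearIndependent ℝ (fun i => I.rowVec θ ρ (e i)) := by
    intro n e θ ρ
    let φ : A →+* ℝ := Polynomial.eval₂RingHom (ev θ) ρ
    have hX : ∀ a, φ (Polynomial.C (MvPolynomial.X a)) = θ a := fun a =>
      (Polynomial.eval₂_C (ev θ) ρ).trans (MvPolynomial.aeval_X θ a)
    have hXρ : φ Polynomial.X = ρ := Polynomial.eval₂_X (ev θ) ρ
    have h1 : φ.mapMatrix (mat n e * (mat n e).transpose) =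
        (Matrix.of fun i => I.rowVec θ ρ (e i)) *
          (Matrix.of fun i => I.rowVec θ ρ (e i)).transpose := by
      ext i i'
      simp only [RingHom.mapMatrix_apply, Matrix.map_apply, Matrix.mul_apply,
        Matrix.transpose_apply, map_sum, map_mul, mat, Matrix.of_apply, map_rowVec, hX, hXρ]
    have h2 : Polynomial.eval₂ (ev θ) ρ (F n e) = φ (F n e) := rfl
    rw [h2, RingHom.map_det, h1, ← linearIndependent_iff_gram_det_ne_zero]
    rfl
  have hρ : ∀ (n : ℕ) (e : Fin n → I.Var ⊕ I.Var), ∃ ρ₀ : ℝ, ∀ ρ, ρ₀ < ρ → ∀ (θ : I.Param → ℝ) (ρ' : ℝ), I.IsVariation θ →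
      LinearIndependent ℝ (fun i => I.rowVec θ ρ' (e i)) →
      LinearIndependent ℝ (fun i => I.rowVec I.paramValue ρ (e i)) := by
    intro n e
    by_cases h0 : (F n e).map (ev I.paramValue) = 0
    -- All coefficients vanish at the data, hence at every variation, so the rows are dependent
    -- there too.
    · refine ⟨0, fun ρ _ θ ρ' hθ h => ?_⟩
      exfalso
      rw [← hF] at h
      apply h
      rw [Polynomial.eval₂_eq_sum_range]
      refine Finset.sum_eq_zero fun k _ => ?_
      have h2 : ev I.paramValue ((F n e).coeff k) = 0 := by
        rw [← Polynomial.coeff_map, h0, Polynomial.coeff_zero]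
      have h3 : ev θ ((F n e).coeff k) = 0 := hgen.generic _ h2 θ hθ
      rw [h3, zero_mul]
    -- A nonzero polynomial in `ρ` has finitely many roots, and `ρ` is taken beyond them.
    · obtain ⟨B, hB⟩ := ((F n e).map (ev I.paramValue)).roots.toFinset.finite_toSet.bddAbove
      refine ⟨B, fun ρ hρ θ ρ' _ _ => ?_⟩
      rw [← hF]
      intro h
      rw [Polynomial.eval₂_eq_eval_map] at h
      have : ρ ∈ ((F n e).map (ev I.paramValue)).roots.toFinset := by
        rw [Multiset.mem_toFinset, Polynomial.mem_roots h0]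
        exact h
      exact absurd (hB this) (not_le.2 hρ)
  choose ρ₀ hρ₀ using hρ
  -- Independent families have at most as many members as there are columns, so finitely many bounds
  -- suffice.
  obtain ⟨B, hB⟩ := (Set.finite_range fun q : Σ n : Fin (Fintype.card I.Col + 1),
    (Fin n → I.Var ⊕ I.Var) => ρ₀ q.1 q.2).bddAbove
  refine ⟨B, fun ρ hρ n e θ ρ' hθ h => ?_⟩
  have hn : n ≤ Fintype.card I.Col := by simpa using h.fintype_card_le_finrank
  refine hρ₀ n e ρ (lt_of_le_of_lt ?_ hρ) θ ρ' hθ h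
  exact hB ⟨⟨⟨n, Nat.lt_succ_of_le hn⟩, e⟩, rfl⟩

theorem finrank_rows_le {I : Market N M} {ρ : ℝ}
    (hρ : ∀ (n : ℕ) (e : Fin n → I.Var ⊕ I.Var) (θ : I.Param → ℝ) (ρ' : ℝ),
      I.IsVariation θ → LinearIndependent ℝ (fun i => I.rowVec θ ρ' (e i)) →
      LinearIndependent ℝ (fun i => I.rowVec I.paramValue ρ (e i)))
    {m : Type*} (e : m → I.Var ⊕ I.Var) {θ : I.Param → ℝ} (hθ : I.IsVariation θ) :
    Module.finrank ℝ (Submodule.span ℝ (Set.range fun i => I.rowVec θ ρ (e i))) ≤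
      Module.finrank ℝ (Submodule.span ℝ (Set.range fun i => I.rowVec I.paramValue ρ (e i))) := by
  obtain ⟨f, hf, -, hli⟩ := Submodule.exists_fun_fin_finrank_span_eq ℝ
    (Set.range fun i => I.rowVec θ ρ (e i))
  choose g hg using hf
  have h1 := hρ _ (fun i => e (g i)) θ ρ hθ (by simpa only [hg] using hli)
  have h2 := finrank_span_eq_card h1
  rw [Fintype.card_fin] at h2
  rw [← h2]
  refine Submodule.finrank_mono (Submodule.span_mono ?_)
  rintro _ ⟨i, rfl⟩
  exact ⟨g i, rfl⟩

/-- A relation between rows that vanish at `x` persists to first order under all variations of the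
parameters. -/
theorem sum_variation_eq_zero {I : Market N M} {ρ : ℝ}
    (hρ : ∀ (n : ℕ) (e : Fin n → I.Var ⊕ I.Var) (θ : I.Param → ℝ) (ρ' : ℝ),
      I.IsVariation θ → LinearIndependent ℝ (fun i => I.rowVec θ ρ' (e i)) →
      LinearIndependent ℝ (fun i => I.rowVec I.paramValue ρ (e i)))
    {x : I.Col → ℝ} {w : I.Var ⊕ I.Var → ℝ}
    (hw : ∀ κ, w κ ≠ 0 → I.row I.paramValue ρ κ x = 0)
    (hrel : ∀ v, ∑ κ, w κ * I.row I.paramValue ρ κ v = 0) (dθ : I.Param → ℝ)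
    (hdθ : ∀ t : ℝ, I.IsVariation (I.paramValue + t • dθ)) :
    ∑ κ, w κ * (I.row (I.paramValue + dθ) ρ κ x - I.row I.paramValue ρ κ x) = 0 := by
  classical
  -- Only the rows in the support of `w` are known to vanish at `x`, so the rank argument is applied
  -- to them alone.
  let T := {κ : I.Var ⊕ I.Var // w κ ≠ 0}
  have hsum : ∀ {V : Type _} [AddCommGroup V] [Module ℝ V] (g : I.Var ⊕ I.Var → V),
      ∑ κ : T, w κ • g κ = ∑ κ, w κ • g κ := by
    intro V _ _ g
    rw [← Fintype.sum_subtype_add_sum_subtype (fun κ => w κ ≠ 0) fun κ => w κ • g κ]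
    refine (add_eq_left.2 (Finset.sum_eq_zero fun κ _ => ?_)).symm
    rw [not_not.1 κ.2, zero_smul]
  let ξ : (I.Col → ℝ) →ₗ[ℝ] ℝ := Fintype.linearCombination ℝ x
  have hξ : ∀ θ κ, ξ (I.rowVec θ ρ κ) = I.row θ ρ κ x := by
    intro θ κ
    rw [row_eq_sum, Fintype.linearCombination_apply]
    exact Finset.sum_congr rfl fun c _ => by rw [smul_eq_mul, mul_comm]
  have key := sum_smul_derivative_mem_ker (m := T) (fun κ => I.rowVec I.paramValue ρ κ)
    (fun κ => I.rowVec (I.paramValue + dθ) ρ κ - I.rowVec I.paramValue ρ κ) (fun κ => w κ) ξ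
    (fun t => by
      have h := finrank_rows_le hρ (fun κ : T => (κ : I.Var ⊕ I.Var)) (hdθ t)
      have h2 : (fun κ : T => I.rowVec I.paramValue ρ κ +
          t • (I.rowVec (I.paramValue + dθ) ρ κ - I.rowVec I.paramValue ρ κ)) =
          fun κ : T => I.rowVec (I.paramValue + t • dθ) ρ κ := by
        funext κ c
        simp only [Pi.add_apply, Pi.smul_apply, Pi.sub_apply, smul_eq_mul, rowVec]
        rw [row_add_smul]
      rw [h2]
      exact h)
    (by
      rw [hsum fun κ => I.rowVec I.paramValue ρ κ]
      funext c
      simpa [Finset.sum_apply, rowVec] using hrel (Pi.single c 1))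
    (fun κ => by rw [hξ]; exact hw κ κ.2)
  rw [hsum fun κ => I.rowVec (I.paramValue + dθ) ρ κ - I.rowVec I.paramValue ρ κ] at key
  simpa only [map_sum, map_smul, map_sub, hξ, smul_eq_mul] using key

end Market

namespace Market

variable {N M : Type*} [Fintype N] [Fintype M] {I : Market N M}

/-! ## Nondegeneracy -/

/-- The vector of all columns at the point `x`. -/
def colVec (P : ℝ) (x : (I.Var → ℝ) × ℝ) : I.Col → ℝ
  | none => P
  | some none => x.2
  | some (some a) => x.1 a

open Classical in
/-- The linear form `ε_j` for the row of a good `j`, and `0` for the other rows. -/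
noncomputable def epsForm (I : Market N M) : I.Var ⊕ I.Var → (M → ℝ) →ₗ[ℝ] ℝ
  | .inr (.p j) => if I.IsGood j then LinearMap.proj j else 0
  | _ => 0

theorem epsForm_eq_zero {κ : I.Var ⊕ I.Var} (h : ∀ j, I.IsGood j → κ ≠ .inr (.p j)) :
    I.epsForm κ = 0 := by
  rcases κ with a | (i | j | ⟨i, j, k⟩ | ⟨i, j, k⟩)
  · rfl
  · rfl
  · exact if_neg fun hj => h j hj rfl
  · rfl
  · rfl

theorem constraintValue_eq {P R : ℝ} (hP : P ≠ 0) (ε : M → ℝ) (x : (I.Var → ℝ) × ℝ)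
    (κ : I.Var ⊕ I.Var) : (I.lcp P R ε).constraintValue x κ =
      I.row I.paramValue (R / P) κ (colVec P x) + I.epsForm κ (fun j => 1 + ε j) * x.2 := by
  rcases κ with a | a
  · simp [AugLCP.constraintValue, row_inl, colVec, epsForm]
  show (I.lcp P R ε).slack x a = _
  rcases a with i | j | ⟨i, j, k⟩ | ⟨i, j, k⟩
  · rw [slack_r, row_r]
    simp only [epsForm, LinearMap.zero_apply, zero_mul, add_zero, colVec]
    congr 1
    refine Finset.sum_congr rfl fun j _ => ?_
    by_cases hj : I.IsGood j <;> simp [sgnInt, sgn, hj, paramValue]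
  · by_cases hj : I.IsGood j
    · rw [slack_p_good I P R ε x hj, row_p]
      simp [epsForm, hj, sgnInt, colVec, total]
    · rw [slack_p_bad I P R ε x hj, row_p]
      simp [epsForm, hj, sgnInt, colVec, total]
  · have hR : R / P * P = R := div_mul_cancel₀ R hP
    by_cases hj : I.IsGood j
    · rw [slack_f_good I P R ε x hj, row_f]
      simp [epsForm, hj, sgnInt, goodInt, colVec, paramValue, hR]
    · rw [slack_f_bad I P R ε x hj, row_f]
      simp [epsForm, hj, sgnInt, goodInt, colVec, paramValue, hR]
  · rw [slack_s, row_s]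
    simp [epsForm, colVec, paramValue]

theorem volume_hyperplane (ℓ : (M → ℝ) →ₗ[ℝ] ℝ) (hℓ : ℓ ≠ 0) (c : ℝ) :
    volume {ε : M → ℝ | ℓ ε = c} = 0 := by
  let s : AffineSubspace ℝ (M → ℝ) :=
    { carrier := {ε | ℓ ε = c}
      smul_vsub_vadd_mem' := fun r p₁ p₂ p₃ h₁ h₂ h₃ => by
        have h₁ : ℓ p₁ = c := h₁
        have h₂ : ℓ p₂ = c := h₂
        have h₃ : ℓ p₃ = c := h₃
        show ℓ (r • (p₁ - p₂) + p₃) = c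
        simp [h₁, h₂, h₃] }
  refine Measure.addHaar_affineSubspace volume s fun htop => hℓ ?_
  have hall : ∀ ε, ℓ ε = c := fun ε => by
    have : ε ∈ s := htop ▸ AffineSubspace.mem_top ℝ _ ε
    exact this
  have h0 : c = 0 := by rw [← hall 0, map_zero]
  ext1 ε
  rw [hall, h0]; rfl

open Classical in
/-- The coefficient of `z` in the relation `w` of rows. -/
noncomputable def zCoeff (I : Market N M) (ρ : ℝ) (ε : M → ℝ) (w : I.Var ⊕ I.Var → ℝ) : ℝ :=
  ∑ κ, w κ * (I.row I.paramValue ρ κ (Pi.single (some none) 1) +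
    I.epsForm κ (fun j => 1 + ε j))

/-- `w` is a relation between the rows in `T`, up to the column of `z`. -/
def IsRelation (I : Market N M) (ρ : ℝ) (T : Set (I.Var ⊕ I.Var)) (w : I.Var ⊕ I.Var → ℝ) :
    Prop :=
  (∀ κ, w κ ≠ 0 → κ ∈ T) ∧
    ∀ v, v (some none) = 0 → ∑ κ, w κ * I.row I.paramValue ρ κ v = 0

/-- For a fixed `w`, the coefficient of `z` is affine in `ε`, nonconstant if a market row of a good
takes part, so it vanishes only on a hyperplane. The relation is chosen from `T` alone,
independently of `ε`, and there are finitely many `T`; hence one null set works for them all. -/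
theorem ae_zCoeff_ne_zero (I : Market N M) (ρ : ℝ) :
    ∀ᵐ ε : M → ℝ, ∀ T : Set (I.Var ⊕ I.Var),
      (∃ w, I.IsRelation ρ T w ∧ ∃ j, I.IsGood j ∧ w (.inr (.p j)) ≠ 0) →
      ∃ w, I.IsRelation ρ T w ∧ I.zCoeff ρ ε w ≠ 0 := by
  classical
  rw [ae_all_iff]
  intro T
  by_cases h : ∃ w, I.IsRelation ρ T w ∧ ∃ j, I.IsGood j ∧ w (.inr (.p j)) ≠ 0
  · obtain ⟨w, hw, j, hj, hne⟩ := h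
    let ℓ : (M → ℝ) →ₗ[ℝ] ℝ := ∑ κ, w κ • I.epsForm κ
    have hz : ∀ ε, I.zCoeff ρ ε w = I.zCoeff ρ 0 w + ℓ ε := by
      intro ε
      simp only [zCoeff, ℓ, LinearMap.sum_apply, LinearMap.smul_apply, smul_eq_mul]
      rw [← Finset.sum_add_distrib]
      refine Finset.sum_congr rfl fun κ _ => ?_
      have : (fun j => 1 + ε j) = (fun j => 1 + (0 : M → ℝ) j) + ε := by
        funext j; simp
      rw [this, map_add]
      ring
    have hℓ : ℓ ≠ 0 := by
      intro h0
      have h1 : ℓ (Pi.single j 1) = 0 := by rw [h0]; rfl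
      simp only [ℓ, LinearMap.sum_apply, LinearMap.smul_apply, smul_eq_mul] at h1
      rw [Finset.sum_eq_single (.inr (.p j))] at h1
      · simp [epsForm, hj] at h1
        exact hne h1
      · intro κ _ hκ
        rcases κ with a | (i | j' | ⟨i, j', k⟩ | ⟨i, j', k⟩)
        · simp [epsForm]
        · simp [epsForm]
        · have : j' ≠ j := fun h => hκ (by rw [h])
          by_cases hj' : I.IsGood j' <;> simp [epsForm, hj', this]
        · simp [epsForm]
        · simp [epsForm]
      · simp
    have hnull := volume_hyperplane ℓ hℓ (-I.zCoeff ρ 0 w)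
    filter_upwards [measure_eq_zero_iff_ae_notMem.1 hnull] with ε hε _
    refine ⟨w, hw, fun h0 => hε ?_⟩
    rw [hz] at h0
    show ℓ ε = _
    linarith
  · exact Filter.Eventually.of_forall fun ε h' => absurd h' h

/-- At a solution with two double labels the tight rows satisfy a relation. -/
theorem exists_relation (I : Market N M) (ρ : ℝ) (Q : AugLCP I.Var) {x : (I.Var → ℝ) × ℝ}
    (hx : x ∈ Q.solutions) {k k' : I.Var} (hk : Q.IsDoubleLabel x k)
    (hk' : Q.IsDoubleLabel x k') (hne : k ≠ k') :
    ∃ w, I.IsRelation ρ {κ | Q.constraintValue x κ = 0} w ∧ w ≠ 0 := by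
  classical
  let T := {κ : I.Var ⊕ I.Var // Q.constraintValue x κ = 0}
  let vec : T → (Option I.Var → ℝ) := fun κ c => I.rowVec I.paramValue ρ κ (c.map some)
  -- Complementarity gives one tight row per variable (`inl` at a double label), and the two double
  -- labels give two more. Without `z` only `|Var| + 1` columns remain.
  have hcard : Fintype.card (Option (Option I.Var)) ≤ Fintype.card T := by
    let g : Option (Option I.Var) → T
      | none => ⟨.inr k, hk.2⟩
      | some none => ⟨.inr k', hk'.2⟩
      | some (some a) => if h : x.1 a = 0 then ⟨.inl a, h⟩ else
          ⟨.inr a, (mul_eq_zero.1 (hx.2 a)).resolve_left h⟩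
    refine Fintype.card_le_of_injective g fun a b hab => ?_
    have hab' : (g a).1 = (g b).1 := congrArg _ hab
    have hk0 : x.1 k = 0 := hk.1
    have hk0' : x.1 k' = 0 := hk'.1
    rcases a with _ | _ | a <;> rcases b with _ | _ | b
    · rfl
    · exact absurd (Sum.inr_injective hab') hne
    · by_cases h : x.1 b = 0
      · simp [g, h] at hab'
      · simp only [g, h, dite_false, Sum.inr.injEq] at hab'
        exact absurd (hab' ▸ hk0) h
    · exact absurd (Sum.inr_injective hab').symm hne
    · rfl
    · by_cases h : x.1 b = 0
      · simp [g, h] at hab'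
      · simp only [g, h, dite_false, Sum.inr.injEq] at hab'
        exact absurd (hab' ▸ hk0') h
    · by_cases h : x.1 a = 0
      · simp [g, h] at hab'
      · simp only [g, h, dite_false, Sum.inr.injEq] at hab'
        exact absurd (hab' ▸ hk0) h
    · by_cases h : x.1 a = 0
      · simp [g, h] at hab'
      · simp only [g, h, dite_false, Sum.inr.injEq] at hab'
        exact absurd (hab' ▸ hk0') h
    · by_cases h : x.1 a = 0 <;> by_cases h' : x.1 b = 0 <;> simp [g, h, h'] at hab' <;>
        rw [hab']
  have hdep : ¬ LinearIndependent ℝ vec := by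
    intro h
    have h1 := h.fintype_card_le_finrank
    rw [Module.finrank_fintype_fun_eq_card] at h1
    simp only [Fintype.card_option] at h1 hcard
    omega
  obtain ⟨g, hg, κ₀, hκ₀⟩ := Fintype.not_linearIndependent_iff.1 hdep
  let w : I.Var ⊕ I.Var → ℝ := fun κ => if h : Q.constraintValue x κ = 0 then g ⟨κ, h⟩ else 0
  have hsum : ∀ f : I.Var ⊕ I.Var → ℝ, ∑ κ, w κ * f κ = ∑ κ : T, g κ * f κ := by
    intro f
    rw [← Fintype.sum_subtype_add_sum_subtype (fun κ => Q.constraintValue x κ = 0)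
      fun κ => w κ * f κ]
    rw [add_eq_left.2 (Finset.sum_eq_zero fun κ _ => by simp [w, κ.2])]
    exact Finset.sum_congr rfl fun κ _ => by simp [w, κ.2]
  refine ⟨w, ⟨fun κ hκ => ?_, fun v hv => ?_⟩, fun h0 => hκ₀ ?_⟩
  · by_contra h
    exact hκ (dif_neg h)
  · simp only [row_eq_sum, Finset.mul_sum]
    rw [Finset.sum_comm]
    refine Finset.sum_eq_zero fun c _ => ?_
    have hc : ∀ c : Option I.Var, ∑ κ, w κ * I.rowVec I.paramValue ρ κ (c.map some) = 0 := by
      intro c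
      rw [hsum]
      have := congrFun hg c
      simpa [vec] using this
    have hcol : c = some none ∨ ∃ c' : Option I.Var, c = c'.map some := by
      rcases c with _ | _ | a
      exacts [Or.inr ⟨none, rfl⟩, Or.inl rfl, Or.inr ⟨some a, rfl⟩]
    rcases hcol with rfl | ⟨c', rfl⟩
    · simp [hv]
    · simp only [mul_left_comm _ (v _)]
      rw [← Finset.mul_sum, hc, mul_zero]
  · have := congrFun h0 κ₀.1
    simpa [w, κ₀.2] using this

/-- Combining the tight constraints at `x` with weights `w` cancels every column except that of `z >
0`. -/
theorem zCoeff_eq_zero {P R : ℝ} (hP : P ≠ 0) {ε : M → ℝ} {x : (I.Var → ℝ) × ℝ} (hz : 0 < x.2)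
    {w : I.Var ⊕ I.Var → ℝ}
    (hw : I.IsRelation (R / P) {κ | (I.lcp P R ε).constraintValue x κ = 0} w) :
    I.zCoeff (R / P) ε w = 0 := by
  classical
  have h1 : ∑ κ, w κ * (I.lcp P R ε).constraintValue x κ = 0 := by
    refine Finset.sum_eq_zero fun κ _ => ?_
    by_cases h : w κ = 0
    · rw [h, zero_mul]
    · rw [show (I.lcp P R ε).constraintValue x κ = 0 from hw.1 κ h, mul_zero]
  have h2 : ∀ κ, w κ * (I.lcp P R ε).constraintValue x κ =
      w κ * I.row I.paramValue (R / P) κ (colVec P (x.1, 0)) +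
      x.2 * (w κ * (I.row I.paramValue (R / P) κ (Pi.single (some none) 1) +
        I.epsForm κ (fun j => 1 + ε j))) := by
    intro κ
    have h3 : colVec P x = colVec P (x.1, 0) + x.2 • Pi.single (some none) 1 := by
      funext c
      rcases c with _ | _ | a <;> simp [colVec]
    rw [constraintValue_eq hP, h3, map_add, map_smul, smul_eq_mul]
    ring
  simp only [h2] at h1
  rw [Finset.sum_add_distrib, hw.2 _ rfl, zero_add, ← Finset.mul_sum] at h1
  exact (mul_eq_zero.1 h1).resolve_left hz.ne'

theorem isVariation_U (hI : I.IsSPLC) [DecidableEq I.Param] {i : N} {j : M}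
    {k : Fin (I.K i j + 1)} (h : I.U i j k ≠ 0) (t : ℝ) :
    I.IsVariation (I.paramValue + t • Pi.single (.U i j k) 1) where
  supply j := by simpa [paramValue] using hI.supply j
  slope_zero i' j' k' h0 := by
    have : Param.U i' j' k' ≠ Param.U i j k := fun he => by
      injection he with h1 h2 h3
      subst h1 h2
      rw [eq_of_heq h3] at h0
      exact h h0
    simp [paramValue, h0, Pi.single_eq_of_ne this]
  endowment_zero i' j' h0 := by simp [paramValue, h0]
  length_last i' j' := by simp [paramValue]

theorem isVariation_L (hI : I.IsSPLC) [DecidableEq I.Param] {i : N} {j : M}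
    {k : Fin (I.K i j + 1)} (h : k ≠ Fin.last _) (t : ℝ) :
    I.IsVariation (I.paramValue + t • Pi.single (.L i j k) 1) where
  supply j := by simpa [paramValue] using hI.supply j
  slope_zero i' j' k' h0 := by simp [paramValue, h0]
  endowment_zero i' j' h0 := by simp [paramValue, h0]
  length_last i' j' := by
    have : Param.L i' j' (Fin.last _) ≠ Param.L i j k := fun he => by
      injection he with h1 h2 h3
      subst h1 h2
      exact h (eq_of_heq h3).symm
    simp [paramValue, Pi.single_eq_of_ne this]

/-- A transfer of an item between two of its owners preserves supply and touches no vanishing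
endowment. -/
theorem isVariation_W (hI : I.IsSPLC) [DecidableEq I.Param] {a b : N} {j : M}
    (ha : 0 < I.W a j) (hb : 0 < I.W b j) (t : ℝ) :
    I.IsVariation (I.paramValue + t • (Pi.single (.W a j) 1 - Pi.single (.W b j) 1)) where
  supply j' := by
    classical
    have h1 : ∀ c : N, ∑ i, (Pi.single (.W c j) 1 : I.Param → ℝ) (.W i j') =
        if j' = j then 1 else 0 := by
      intro c
      simp [Pi.single_apply, ite_and]
    simp only [Pi.add_apply, Pi.smul_apply, Pi.sub_apply, smul_eq_mul, Finset.sum_add_distrib,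
      ← Finset.mul_sum, Finset.sum_sub_distrib, h1]
    simpa [paramValue] using hI.supply j'
  slope_zero i' j' k' h0 := by simp [paramValue, h0]
  endowment_zero i' j' h0 := by
    have hne : ∀ c, 0 < I.W c j → Param.W i' j' ≠ (Param.W c j : I.Param) := fun c hc he => by
      injection he with h1 h2
      subst h1 h2
      exact hc.ne' h0
    simp [paramValue, h0, Pi.single_eq_of_ne (hne a ha), Pi.single_eq_of_ne (hne b hb)]
  length_last i' j' := by simp [paramValue]

section RowVariation

variable [DecidableEq I.Param] (θ : I.Param → ℝ) (ρ : ℝ) (v : I.Col → ℝ)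

theorem row_variation_U {i : N} {j : M} {k : Fin (I.K i j + 1)} (w : I.Var ⊕ I.Var → ℝ) :
    ∑ κ, w κ * (I.row (θ + Pi.single (.U i j k) 1) ρ κ v - I.row θ ρ κ v) =
      -(w (.inr (.f i j k)) * (ρ * v none - v (some (some (.r i))))) := by
  rw [Finset.sum_eq_single (.inr (.f i j k))]
  · simp only [row_f, Pi.add_apply, Pi.single_eq_same]; ring
  · rintro (a | (i' | j' | ⟨i', j', k'⟩ | ⟨i', j', k'⟩)) - hne
    · simp [row_inl]
    · simp [row_r]
    · simp [row_p]
    · have : Param.U i' j' k' ≠ Param.U i j k := fun he => by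
        injection he with h1 h2 h3
        subst h1 h2
        exact hne (by rw [eq_of_heq h3])
      simp [row_f, Pi.single_eq_of_ne this]
    · simp [row_s]
  · simp

theorem row_variation_L {i : N} {j : M} {k : Fin (I.K i j + 1)} (w : I.Var ⊕ I.Var → ℝ) :
    ∑ κ, w κ * (I.row (θ + Pi.single (.L i j k) 1) ρ κ v - I.row θ ρ κ v) =
      w (.inr (.s i j k)) * (v none - v (some (some (.p j)))) := by
  rw [Finset.sum_eq_single (.inr (.s i j k))]
  · simp only [row_s, Pi.add_apply, Pi.single_eq_same]; ring
  · rintro (a | (i' | j' | ⟨i', j', k'⟩ | ⟨i', j', k'⟩)) - hne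
    · simp [row_inl]
    · simp [row_r]
    · simp [row_p]
    · simp [row_f]
    · have : Param.L i' j' k' ≠ Param.L i j k := fun he => by
        injection he with h1 h2 h3
        subst h1 h2
        exact hne (by rw [eq_of_heq h3])
      simp [row_s, Pi.single_eq_of_ne this]
  · simp

theorem row_variation_W {a b : N} (hab : a ≠ b) {j : M} (w : I.Var ⊕ I.Var → ℝ) :
    ∑ κ, w κ * (I.row (θ + (Pi.single (.W a j) 1 - Pi.single (.W b j) 1)) ρ κ v -
        I.row θ ρ κ v) =
      (w (.inr (.r a)) - w (.inr (.r b))) *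
        ((I.sgnInt j : ℝ) * (v none - v (some (some (.p j))))) := by
  classical
  have hrow : ∀ i, I.row (θ + (Pi.single (.W a j) 1 - Pi.single (.W b j) 1)) ρ (.inr (.r i)) v -
      I.row θ ρ (.inr (.r i)) v = ((if i = a then 1 else 0) - if i = b then 1 else 0) *
        ((I.sgnInt j : ℝ) * (v none - v (some (some (.p j))))) := by
    intro i
    simp only [row_r, add_sub_add_right_eq_sub, ← Finset.sum_sub_distrib]
    rw [Finset.sum_eq_single j]
    · simp only [Pi.add_apply, Pi.sub_apply, Pi.single_apply, Param.W.injEq, and_true]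
      ring
    · intro j' _ hj'
      simp [hj']
    · simp
  rw [Fintype.sum_eq_add (.inr (.r a)) (.inr (.r b)) (by simpa using hab)]
  · rw [hrow, hrow]
    simp [hab, hab.symm]
    ring
  · rintro (c | (i | j' | ⟨i', j', k'⟩ | ⟨i', j', k'⟩)) ⟨h1, h2⟩
    · simp [row_inl]
    · rw [hrow]
      have h1 : i ≠ a := fun h => h1 (by rw [h])
      have h2 : i ≠ b := fun h => h2 (by rw [h])
      simp [h1, h2]
    · simp [row_p]
    · simp [row_f]
    · simp [row_s]

end RowVariation

theorem sum_single_f [DecidableEq I.Col] (i : N) (j j' : M) (k : Fin (I.K i j + 1)) (h : j' ≠ j) :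
    ∑ i', ∑ k', (Pi.single (some (some (.f i j k))) 1 : I.Col → ℝ)
      (some (some (.f i' j' k'))) = 0 := by
  simp [h]

theorem sum_single_f_self [DecidableEq I.Col] (i : N) (j : M) (k : Fin (I.K i j + 1)) :
    ∑ i', ∑ k', (Pi.single (some (some (.f i j k))) 1 : I.Col → ℝ)
      (some (some (.f i' j k'))) = 1 := by
  rw [Finset.sum_eq_single i, Finset.sum_eq_single k]
  · simp
  · intro k' _ hk'
    simp [hk']
  · simp
  · intro i' _ hi'
    simp [hi']
  · simp

/-- The coefficient of `f_ijk` in a relation. -/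
theorem relation_f [DecidableEq I.Col] (θ : I.Param → ℝ) (ρ : ℝ) {w : I.Var ⊕ I.Var → ℝ}
    (hr : ∀ i, w (.inr (.r i)) = 0) (i : N) (j : M) (k : Fin (I.K i j + 1)) :
    ∑ κ, w κ * I.row θ ρ κ (Pi.single (some (some (.f i j k))) 1) =
      w (.inl (.f i j k)) + (w (.inr (.p j)) * I.sgnInt j - w (.inr (.s i j k))) := by
  classical
  rw [Fintype.sum_sum_type]
  congr 1
  · rw [Finset.sum_eq_single (.f i j k)]
    · simp [row_inl]
    · intro a _ ha
      simp [row_inl, ha]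
    · simp
  · rw [Fintype.sum_eq_add (.p j) (.s i j k) (by simp)]
    · simp only [row_p, sum_single_f_self, row_s]
      simp
      ring
    · rintro (i' | j' | ⟨i', j', k'⟩ | ⟨i', j', k'⟩) ⟨h1, h2⟩
      · simp [hr]
      · have : j' ≠ j := fun h => h1 (by rw [h])
        simp only [row_p, sum_single_f i j j' k this]
        simp
      · simp [row_f]
      · have : Var.f i' j' k' ≠ (Var.f i j k : I.Var) := fun he => by
          injection he with e1 e2 e3
          subst e1 e2
          exact h2 (by rw [eq_of_heq e3])
        simp [row_s, this]

end Market

/-! ### At most one double label for generic data -/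

namespace Market

variable {N M : Type*} [Fintype N] [Fintype M] {I : Market N M}

/-- For generic parameters, large `R / P` and almost every `ε`, the solutions in the region with
`z > 0` have at most one double label. -/
theorem nondegenerate [Nonempty N] (hI : I.IsSPLC) (hgen : I.NoPolynomialRelation) {P R : ℝ}
    (hP : 0 < P) {ε : M → ℝ}
    (hρ : ∀ (n : ℕ) (e : Fin n → I.Var ⊕ I.Var) (θ : I.Param → ℝ) (ρ' : ℝ),
      I.IsVariation θ → LinearIndependent ℝ (fun i => I.rowVec θ ρ' (e i)) →
      LinearIndependent ℝ (fun i => I.rowVec I.paramValue (R / P) (e i)))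
    (hε : ∀ T : Set (I.Var ⊕ I.Var),
      (∃ w, I.IsRelation (R / P) T w ∧ ∃ j, I.IsGood j ∧ w (.inr (.p j)) ≠ 0) →
      ∃ w, I.IsRelation (R / P) T w ∧ I.zCoeff (R / P) ε w ≠ 0)
    {x : (I.Var → ℝ) × ℝ} (hx : x ∈ (I.lcp P R ε).solutions) (hxΩ : x ∈ I.region P R)
    (hz : 0 < x.2) {k k' : I.Var} (hk : (I.lcp P R ε).IsDoubleLabel x k)
    (hk' : (I.lcp P R ε).IsDoubleLabel x k') : k = k' := by
  classical
  by_contra hne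
  set Q := I.lcp P R ε with hQ
  set ρ := R / P with hρdef
  obtain ⟨w, hw, hw0⟩ := I.exists_relation ρ Q hx hk hk' hne
  -- By the choice of `ε`, market rows of goods cannot take part; from here on `ε` has disappeared
  -- from the relation.
  have hgood : ∀ j, I.IsGood j → w (.inr (.p j)) = 0 := by
    intro j hj
    by_contra h
    obtain ⟨w', hw', hzc⟩ := hε _ ⟨w, hw, j, hj, h⟩
    exact hzc (zCoeff_eq_zero hP.ne' hz hw')
  have heps : ∀ κ, w κ ≠ 0 → I.epsForm κ = 0 := fun κ hκ =>
    epsForm_eq_zero fun j hj h => hκ (h ▸ hgood j hj)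
  have hzrel : ∑ κ, w κ * I.row I.paramValue ρ κ (Pi.single (some none) 1) = 0 := by
    rw [← zCoeff_eq_zero hP.ne' hz hw, zCoeff]
    refine Finset.sum_congr rfl fun κ _ => ?_
    by_cases h : w κ = 0
    · simp [h]
    · simp [heps κ h, hρdef]
  have hrel : ∀ v, ∑ κ, w κ * I.row I.paramValue ρ κ v = 0 := by
    intro v
    have hv : v = Function.update v (some none) 0 + v (some none) • Pi.single (some none) 1 := by
      funext c
      by_cases hc : c = some none
      · subst hc; simp
      · simp [hc]
    have h1 := hw.2 (Function.update v (some none) 0) (by simp)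
    rw [hv]
    simp only [map_add, map_smul, smul_eq_mul, mul_add, Finset.sum_add_distrib,
      mul_left_comm _ (v (some none))]
    rw [← Finset.mul_sum, hzrel]
    simpa using h1
  have htight : ∀ κ, w κ ≠ 0 → Q.constraintValue x κ = 0 := fun κ h => hw.1 κ h
  have hrow : ∀ κ, w κ ≠ 0 → I.row I.paramValue ρ κ (colVec P x) = 0 := by
    intro κ h
    have h1 := htight κ h
    rw [hQ, constraintValue_eq hP.ne', heps κ h] at h1
    simpa using h1
  have hvar := sum_variation_eq_zero hρ hrow hrel
  have hπ : ∀ j, 0 < P - x.1 (.p j) := fun j => sub_pos.2 (hxΩ.1 j)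
  have hlam : ∀ i, 0 < R - x.1 (.r i) := fun i => sub_pos.2 (hxΩ.2 i)
  have hψ : ∀ i j k, w (.inr (.f i j k)) = 0 := by
    intro i j k
    by_contra h
    -- Vanishing slopes may not be varied, but their rows are not tight, as `π + s + z > 0`.
    have hU : I.U i j k ≠ 0 := by
      by_cases hj : I.IsGood j
      · intro h0
        have h1 : Q.slack x (.f i j k) = 0 := htight _ h
        rw [hQ, slack_f_good I P R ε x hj, h0] at h1
        have h2 := hx.1.1 (.s i j k)
        have h3 := hπ j
        linarith
      · exact (disutility_neg hI hj i k).ne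
    have h1 := hvar _ (isVariation_U hI hU)
    rw [row_variation_U, neg_eq_zero] at h1
    rcases mul_eq_zero.1 h1 with h2 | h2
    · exact h h2
    · have h3 : ρ * P - x.1 (.r i) = 0 := h2
      rw [hρdef, div_mul_cancel₀ R hP.ne'] at h3
      exact (hlam i).ne' h3
  have hχ : ∀ i j k, k ≠ Fin.last _ → w (.inr (.s i j k)) = 0 := by
    intro i j k hkl
    have h1 := hvar _ (isVariation_L hI hkl)
    rw [row_variation_L] at h1
    exact (mul_eq_zero.1 h1).resolve_right (hπ j).ne'
  have hμ : ∀ a b, w (.inr (.r a)) = w (.inr (.r b)) := by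
    intro a b
    refine Relation.ReflTransGen.head_induction_on (hgen.coowned a b) rfl ?_
    rintro c d ⟨j, hc, hd⟩ - ih
    by_cases hcd : c = d
    · rw [hcd, ih]
    have h1 := hvar _ (isVariation_W hI hc hd)
    rw [row_variation_W _ _ _ hcd] at h1
    rw [← ih]
    refine sub_eq_zero.1 ((mul_eq_zero.1 h1).resolve_right (mul_ne_zero ?_ (hπ j).ne'))
    by_cases hj : I.IsGood j <;> simp [sgnInt, hj]
  -- The budget rows carry equal weights and are the only remaining rows that contain `z`.
  have hμ0 : ∀ i, w (.inr (.r i)) = 0 := by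
    intro i
    let ind : I.Var ⊕ I.Var → ℝ
      | .inr (.r _) => 1
      | _ => 0
    have hterm : ∀ κ, w κ * I.row I.paramValue ρ κ (Pi.single (some none) 1) =
        w (.inr (.r i)) * ind κ := by
      rintro (a | (i' | j | ⟨i', j, k⟩ | ⟨i', j, k⟩))
      · simp [row_inl, ind]
      · rw [hμ i' i]; simp [row_r, ind]
      · simp [row_p, ind]
      · simp [hψ, ind]
      · simp [row_s, ind]
    have hpos : 0 < ∑ κ, ind κ := by
      refine Finset.sum_pos' (fun κ _ => ?_) ⟨.inr (.r i), Finset.mem_univ _, zero_lt_one⟩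
      rcases κ with a | (i' | j | ⟨i', j, k⟩ | ⟨i', j, k⟩) <;> simp [ind]
    simp only [hterm] at hzrel
    rw [← Finset.mul_sum] at hzrel
    exact (mul_eq_zero.1 hzrel).resolve_right hpos.ne'
  have hf : ∀ i j k, w (.inl (.f i j k)) +
      (w (.inr (.p j)) * I.sgnInt j - w (.inr (.s i j k))) = 0 := fun i j k => by
    rw [← relation_f I.paramValue ρ hμ0 i j k]
    exact hrel _
  have hfpos : ∀ i j k, 0 < x.1 (.f i j k) → w (.inl (.f i j k)) = 0 := by
    intro i j k hpos
    by_contra h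
    exact hpos.ne' (htight _ h)
  have hsat : ∀ i j k, w (.inr (.s i j k)) ≠ 0 →
      x.1 (.f i j k) = I.L i j k * (P - x.1 (.p j)) := by
    intro i j k h
    have h1 : Q.slack x (.s i j k) = 0 := htight _ h
    rw [hQ, slack_s] at h1
    linarith
  -- If the row of a bad takes part, someone earns on the bad. In the column of her `f > 0` only `w
  -- (.inr (.p j))` can remain, because a last segment is never full.
  have hν : ∀ j, w (.inr (.p j)) = 0 := by
    intro j
    by_cases hj : I.IsGood j
    · exact hgood j hj
    by_contra h
    have h1 : Q.slack x (.p j) = 0 := htight _ h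
    rw [hQ, slack_p_bad I P R ε x hj] at h1
    have h2 : 0 < total x.1 j := by have := hπ j; linarith
    obtain ⟨i, -, hi⟩ := Finset.exists_lt_of_sum_lt (s := Finset.univ)
      (f := fun _ : N => (0 : ℝ)) (by simpa [total] using h2)
    obtain ⟨k, -, hk⟩ := Finset.exists_lt_of_sum_lt (s := Finset.univ)
      (f := fun _ : Fin (I.K i j + 1) => (0 : ℝ)) (by simpa using hi)
    have h3 := hf i j k
    rw [hfpos i j k hk] at h3
    have hs : w (.inr (.s i j k)) = 0 := by
      by_cases hl : k = Fin.last _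
      · by_contra hs
        have h4 := hsat i j k hs
        have h5 := f_le_total hx.1.1 i j k
        have h6 := hI.one_lt_length_last i j
        rw [← hl] at h6
        have h7 := hπ j
        nlinarith
      · exact hχ i j k hl
    rw [hs] at h3
    simp [sgnInt, hj] at h3
    exact h h3
  have hχ0 : ∀ i j k, w (.inr (.s i j k)) = 0 := by
    intro i j k
    by_contra h
    have h1 : 0 < x.1 (.f i j k) := by
      rw [hsat i j k h]
      exact mul_pos (hI.length_pos i j k) (hπ j)
    have h2 := hf i j k
    rw [hfpos i j k h1, hν j] at h2
    simp at h2
    exact h h2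
  have hinr : ∀ a, w (.inr a) = 0 := by
    rintro (i | j | ⟨i, j, k⟩ | ⟨i, j, k⟩)
    exacts [hμ0 i, hν j, hψ i j k, hχ0 i j k]
  refine hw0 (funext fun κ => ?_)
  rcases κ with a | a
  · have h1 := hrel (Pi.single (some (some a)) 1)
    rw [Fintype.sum_sum_type, Finset.sum_eq_zero (s := Finset.univ)
      (f := fun b => w (.inr b) * _) (fun b _ => by rw [hinr, zero_mul]), add_zero,
      Finset.sum_eq_single a] at h1
    · simpa [row_inl] using h1
    · intro b _ hb
      simp [row_inl, hb]
    · simp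
  · exact hinr a

end Market

/-- Along a ray `z` cannot decrease, so the half-line from `x` on is a half-line of solutions in `Ω`
with `z > 0`, hence primary. Then the vertex of the ray is the start and the ray is the whole
primary ray. -/
theorem AugLCP.Regular.notMem_secondaryRay {ι : Type*} {Q : AugLCP ι}
    {Ω : Set ((ι → ℝ) × ℝ)} {z₀ : ℝ} (H : Q.Regular Ω z₀) {x : (ι → ℝ) × ℝ} (hx : x ∈ Ω)
    {E : Set ((ι → ℝ) × ℝ)} (hE : Q.IsSecondaryRay E) : x ∉ E := by
  intro hxE
  obtain ⟨⟨x₀, hx₀, hz, d, hd, rfl, -, hsol⟩, hne⟩ := hE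
  obtain ⟨α, hα, rfl⟩ := hxE
  have hdz : 0 ≤ d.2 := by
    by_contra hneg
    push Not at hneg
    have h1 := (hsol ⟨(x₀.2 + 1) / -d.2, div_nonneg (by linarith) (by linarith), rfl⟩).1.2.2
    have h2 : (x₀.2 + 1) / -d.2 * d.2 = -(x₀.2 + 1) := by
      rw [div_mul_eq_mul_div, div_eq_iff (by linarith)]; ring
    simp only [Prod.snd_add, Prod.smul_snd, smul_eq_mul, h2] at h1
    linarith
  have hpos : 0 < (x₀ + α • d).2 := by
    have := mul_nonneg hα hdz
    simp only [Prod.snd_add, Prod.smul_snd, smul_eq_mul]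
    linarith
  obtain ⟨h1, h2⟩ := H.ray _ d hx hpos hd fun β hβ =>
    hsol ⟨α + β, by positivity, by rw [add_smul, add_assoc]⟩
  have h3 : x₀.1 = 0 := by simpa [h2] using h1
  have h4 := H.vertex_eq_start hx₀ h3
  subst h4
  have hd2 : 0 < d.2 := lt_of_le_of_ne hdz fun h => hd (Prod.ext h2 h.symm)
  refine hne (Set.ext fun y => ⟨?_, ?_⟩)
  · rintro ⟨β, hβ, rfl⟩
    exact ⟨hsol ⟨β, hβ, rfl⟩, by simp [h2]⟩
  · rintro ⟨hys, hy1⟩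
    have hy : y = (0, y.2) := Prod.ext hy1 rfl
    rw [hy] at hys
    have h5 := (H.start_sol y.2).1 hys
    refine ⟨(y.2 - z₀) / d.2, div_nonneg (by linarith) hdz, Prod.ext ?_ ?_⟩
    · simp [h2, hy1]
    · simp only [Prod.snd_add, Prod.smul_snd, smul_eq_mul]
      field_simp
      ring

namespace Market

variable {N M : Type*} {I : Market N M}

/-! ## Segments of the utility functions -/

theorem fill_nonneg (hL : ∀ i j k, 0 < I.L i j k) (i : N) (j : M) (k : Fin (I.K i j + 1)) (t : ℝ) :
    0 ≤ I.fill i j k t := by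
  unfold fill
  split_ifs
  · exact le_max_left _ _
  · exact le_min (hL i j k).le (le_max_left _ _)

theorem min_max_eq_sub {L u : ℝ} (hL : 0 ≤ L) :
    min L (max 0 u) = max 0 u - max 0 (u - L) := by
  rcases le_total u 0 with h | h
  · rw [max_eq_left h, min_eq_right hL, max_eq_left (by linarith), sub_zero]
  · rw [max_eq_right h]
    rcases le_total u L with h' | h'
    · rw [min_eq_right h', max_eq_left (by linarith), sub_zero]
    · rw [min_eq_left h', max_eq_right (by linarith)]; ring

theorem sum_fill (hL : ∀ i j k, 0 < I.L i j k) (i : N) (j : M) {t : ℝ} (ht : 0 ≤ t) :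
    ∑ k, I.fill i j k t = t := by
  let S : ℕ → ℝ := fun m => ∑ l : Fin (I.K i j + 1) with l.val < m, I.L i j l
  -- The amount beyond the first `m` segments. A finite segment holds `G k - G (k + 1)` and the
  -- infinite last one holds `G K`, so the sum telescopes.
  let G : ℕ → ℝ := fun m => max 0 (t - S m)
  have hIio : ∀ k : Fin (I.K i j + 1), ∑ l ∈ Finset.Iio k, I.L i j l = S k.val := by
    intro k
    refine Finset.sum_congr ?_ fun _ _ => rfl
    ext l
    simp
  have hsucc : ∀ k : Fin (I.K i j + 1), S (k.val + 1) = S k.val + I.L i j k := by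
    intro k
    have : (Finset.univ.filter fun l : Fin (I.K i j + 1) => l.val < k.val + 1) =
        insert k (Finset.univ.filter fun l : Fin (I.K i j + 1) => l.val < k.val) := by
      ext l
      simp only [Finset.mem_filter, Finset.mem_univ, true_and, Finset.mem_insert, Fin.ext_iff]
      omega
    simp only [S]
    rw [this, Finset.sum_insert (by simp), add_comm]
  rw [Fin.sum_univ_castSucc]
  have h1 : ∀ k : Fin (I.K i j), I.fill i j k.castSucc t = G k.val - G (k.val + 1) := by
    intro k
    rw [fill, if_neg (Fin.castSucc_lt_last k).ne, hIio, min_max_eq_sub (hL i j _).le]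
    have := hsucc k.castSucc
    simp only [Fin.val_castSucc] at this
    simp only [G, this, Fin.val_castSucc, sub_sub]
  have h2 : I.fill i j (Fin.last _) t = G (I.K i j) := by
    rw [fill, if_pos rfl, hIio]; rfl
  rw [h2, Finset.sum_congr rfl fun k _ => h1 k,
    Fin.sum_univ_eq_sum_range (fun m => G m - G (m + 1)), Finset.sum_range_sub']
  simp [G, S, ht]

/-- An amount that uses the segments of slope above `θ` fully, and those of slope below `θ` not
at all, maximizes utility minus `θ` times the amount. -/
theorem sum_fill_sub_le (hI : ∀ i j, StrictAnti (I.U i j)) (hL : ∀ i j k, 0 < I.L i j k)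
    (i : N) (j : M) (θ : ℝ) (x : Fin (I.K i j + 1) → ℝ) (hx0 : ∀ k, 0 ≤ x k)
    (hxL : ∀ k, x k ≤ I.L i j k)
    (hgt : ∀ k, θ < I.U i j k → k ≠ Fin.last _ ∧ x k = I.L i j k)
    (hlt : ∀ k, I.U i j k < θ → x k = 0) {y : ℝ} (hy : 0 ≤ y) :
    ∑ k, I.U i j k * I.fill i j k y - θ * y ≤
      ∑ k, I.U i j k * I.fill i j k (∑ k, x k) - θ * ∑ k, x k := by
  have hX : 0 ≤ ∑ k, x k := Finset.sum_nonneg fun k _ => hx0 k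
  -- The fills add up to `t`, so the objective splits into one term per segment and each term is
  -- maximized separately.
  have hre : ∀ t, 0 ≤ t → ∑ k, I.U i j k * I.fill i j k t - θ * t =
      ∑ k, (I.U i j k - θ) * I.fill i j k t := by
    intro t ht
    simp only [sub_mul, Finset.sum_sub_distrib, ← Finset.mul_sum, sum_fill hL i j ht]
  rw [hre y hy, hre _ hX]
  refine Finset.sum_le_sum fun k _ => ?_
  rcases lt_trichotomy (I.U i j k) θ with h | h | h
  · have h0 : I.fill i j k (∑ k, x k) = 0 := by
      have hle : ∑ k, x k ≤ ∑ l ∈ Finset.Iio k, I.L i j l := by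
        rw [← Finset.sum_subset (Finset.subset_univ (Finset.Iio k))]
        · exact Finset.sum_le_sum fun l _ => hxL l
        · intro l _ hl
          rw [Finset.mem_Iio, not_lt] at hl
          exact hlt l (((hI i j).antitone hl).trans_lt h)
      unfold fill
      rw [max_eq_left (by linarith)]
      split_ifs
      · rfl
      · exact min_eq_right (hL i j k).le
    rw [h0, mul_zero]
    exact mul_nonpos_of_nonpos_of_nonneg (by linarith) (fill_nonneg hL i j k y)
  · rw [h, sub_self, zero_mul, zero_mul]
  · have hk := (hgt k h).1
    have h1 : I.fill i j k (∑ k, x k) = I.L i j k := by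
      unfold fill
      rw [if_neg hk]
      refine min_eq_left (le_max_of_le_right ?_)
      have hsub : ∑ l ∈ Finset.Iio k, I.L i j l + I.L i j k = ∑ l ∈ Finset.Iic k, x l := by
        rw [← Finset.Iio_insert, Finset.sum_insert (by simp), add_comm, (hgt k h).2]
        congr 1
        exact Finset.sum_congr rfl fun l hl =>
          (hgt l (h.trans_le ((hI i j).antitone (Finset.mem_Iio.1 hl).le))).2.symm
      have hle : ∑ l ∈ Finset.Iic k, x l ≤ ∑ l, x l :=
        Finset.sum_le_sum_of_subset_of_nonneg (Finset.subset_univ _) fun l _ _ => hx0 l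
      linarith
    rw [h1]
    refine mul_le_mul_of_nonneg_left ?_ (by linarith)
    unfold fill
    rw [if_neg hk]
    exact min_le_left _ _

variable [Fintype N] [Fintype M]

/-- Solutions with `z = 0` in the region are competitive equilibria. -/
theorem isCompetitiveEquilibrium [Nonempty N] (hI : I.IsSPLC) {P R : ℝ} {ε : M → ℝ}
    {x : (I.Var → ℝ) × ℝ} (hx : x ∈ (I.lcp P R ε).solutions) (hxΩ : x ∈ I.region P R)
    (hz : x.2 = 0) : I.IsCompetitiveEquilibrium (I.price P x.1) (I.allocation P x.1) := by
  have hπ : ∀ j, 0 < P - x.1 (.p j) := fun j => sub_pos.2 (hxΩ.1 j)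
  have hlam : ∀ i, 0 < R - x.1 (.r i) := fun i => sub_pos.2 (hxΩ.2 i)
  have hitem : ∀ j ∈ Finset.univ, I.sgn j * ((P - x.1 (.p j)) - total x.1 j) ≤ 0 := by
    intro j _
    have h := hx.1.2.1 (.p j)
    by_cases hj : I.IsGood j
    · rw [slack_p_good I P R ε x hj, hz] at h
      rw [sgn_of_good hj]; linarith
    · rw [slack_p_bad I P R ε x hj] at h
      rw [sgn_of_bad hj]; linarith
  have hsum := sum_slack_r (P := P) (R := R) (ε := ε) (x := x) hI
  rw [hz, mul_zero, add_zero] at hsum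
  -- At `z = 0` Walras's law equates a sum of nonnegative budget slacks with a sum of nonpositive
  -- terms; hence all budgets bind and all markets clear.
  have hnn : ∀ i ∈ Finset.univ, 0 ≤ (I.lcp P R ε).slack x (.r i) := fun i _ => hx.1.2.1 _
  have h1 := Finset.sum_nonneg hnn
  have h2 := Finset.sum_nonpos hitem
  have hbudget : ∀ i, (I.lcp P R ε).slack x (.r i) = 0 := fun i =>
    (Finset.sum_eq_zero_iff_of_nonneg hnn).1 (by linarith) i (Finset.mem_univ i)
  have htotal : ∀ j, total x.1 j = P - x.1 (.p j) := by
    intro j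
    have h3 := (Finset.sum_eq_zero_iff_of_nonpos hitem).1 (by linarith) j (Finset.mem_univ j)
    have h4 : I.sgn j ≠ 0 := by
      by_cases hj : I.IsGood j
      · rw [sgn_of_good hj]; norm_num
      · rw [sgn_of_bad hj]; norm_num
    linarith [(mul_eq_zero.1 h3).resolve_left h4]
  have hslack : ∀ i j k, (I.lcp P R ε).slack x (.f i j k) =
      I.sgn j * (P - x.1 (.p j)) - I.U i j k * (R - x.1 (.r i)) + x.1 (.s i j k) := by
    intro i j k
    by_cases hj : I.IsGood j
    · rw [slack_f_good I P R ε x hj, sgn_of_good hj, hz]; ring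
    · rw [slack_f_bad I P R ε x hj, sgn_of_bad hj]; ring
  have hspend : ∀ i, ∑ j, I.allocation P x.1 i j * I.price P x.1 j =
      ∑ j, I.W i j * I.price P x.1 j := by
    intro i
    have h3 := hbudget i
    rw [slack_r, hz, add_zero] at h3
    refine (sub_eq_zero.1 ?_).symm
    rw [← h3, ← Finset.sum_sub_distrib]
    refine Finset.sum_congr rfl fun j _ => ?_
    have := (hπ j).ne'
    rw [allocation, price]
    field_simp
  refine ⟨fun i => ⟨fun j => div_nonneg (Finset.sum_nonneg fun _ _ => hx.1.1 _) (hπ j).le,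
    hspend i, fun y hy hyb => ?_⟩, fun j => ?_⟩
  · let θ : M → ℝ := fun j => I.price P x.1 j / (R - x.1 (.r i))
    have hitem : ∀ j ∈ Finset.univ, ∑ k, I.U i j k * I.fill i j k (y j) - θ j * y j ≤
        ∑ k, I.U i j k * I.fill i j k (I.allocation P x.1 i j) -
          θ j * I.allocation P x.1 i j := by
      intro j _
      have halloc : I.allocation P x.1 i j =
          ∑ k, x.1 (.f i j k) / (P - x.1 (.p j)) := by rw [allocation, Finset.sum_div]
      rw [halloc]
      refine sum_fill_sub_le hI.slope_strictAnti hI.length_pos i j (θ j)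
        (fun k => x.1 (.f i j k) / (P - x.1 (.p j)))
        (fun k => div_nonneg (hx.1.1 _) (hπ j).le)
        (fun k => (div_le_iff₀ (hπ j)).2 (f_le hx.1 i j k)) (fun k hk => ?_) (fun k hk => ?_) (hy j)
      -- A slope above the threshold forces `s > 0`, hence a full segment. It is not the last one,
      -- which is longer than the supply.
      · have h3 : I.sgn j * (P - x.1 (.p j)) < I.U i j k * (R - x.1 (.r i)) :=
          (div_lt_iff₀ (hlam i)).1 hk
        have h4 := hx.1.2.1 (.f i j k)
        rw [hslack] at h4
        have h5 := slack_eq_zero hx (a := .s i j k) (by linarith)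
        rw [slack_s] at h5
        refine ⟨fun hl => ?_, by rw [div_eq_iff (hπ j).ne']; linarith⟩
        have h6 := f_le_total hx.1.1 i j k
        rw [htotal] at h6
        have h7 := hI.one_lt_length_last i j
        rw [← hl] at h7
        have h8 := hπ j
        nlinarith
      · have h3 : I.U i j k * (R - x.1 (.r i)) < I.sgn j * (P - x.1 (.p j)) :=
          (lt_div_iff₀ (hlam i)).1 hk
        have h4 := hx.1.1 (.s i j k)
        have h5 : (I.lcp P R ε).slack x (.f i j k) ≠ 0 := by
          rw [hslack]
          exact ne_of_gt (by linarith)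
        rw [(mul_eq_zero.1 (hx.2 (.f i j k))).resolve_right h5, zero_div]
    have h3 := Finset.sum_le_sum hitem
    rw [Finset.sum_sub_distrib, Finset.sum_sub_distrib] at h3
    have h4 : ∀ u : M → ℝ, ∑ j, θ j * u j =
        (∑ j, u j * I.price P x.1 j) / (R - x.1 (.r i)) := by
      intro u
      rw [Finset.sum_div]
      exact Finset.sum_congr rfl fun j _ => by simp only [θ]; ring
    rw [h4, h4, hyb, hspend i] at h3
    exact sub_le_sub_iff_right _ |>.1 h3
  · rw [hI.supply j]
    simp only [allocation]
    rw [← Finset.sum_div]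
    have := htotal j
    rw [total] at this
    rw [this, div_self (hπ j).ne']

end Market

theorem mainTheorem2 {N M : Type*} [Fintype N] [Fintype M] [Nonempty N] (I : Market N M)
    (hI : I.IsSPLC) (hconn : I.StronglyConnected) (hgen : I.NoPolynomialRelation)
    (P : ℝ) (hP : 0 < P) :
    ∃ R₀ : ℝ, ∀ R : ℝ, R₀ < R →
      ∀ᵐ ε : M → ℝ ∂(volume.restrict
        (Set.univ.pi fun _ : M => Set.Ioo (0 : ℝ) (1 / (Fintype.card M : ℝ)))),
      ∃ (T : ℕ) (S : ℕ → (I.Var → ℝ) × ℝ),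
        -- the algorithm makes `T` pivots, through vertex solutions, and stops with `z = 0`
        (I.lcp P R ε).IsRun (I.startZ P R) S T ∧ (S T).2 = 0 ∧
        (∀ t ≤ T, S t ∈ (I.lcp P R ε).vertices ∧ S t ∈ (I.lcp P R ε).solutions) ∧
        -- its course is determined: there is always exactly one double label, and every run is
        -- an initial part of this one
        (∀ t < T, ∃! k, (I.lcp P R ε).IsDoubleLabel (S t) k) ∧
        (∀ (T' : ℕ) (S' : ℕ → (I.Var → ℝ) × ℝ), (I.lcp P R ε).IsRun (I.startZ P R) S' T' →
          T' ≤ T ∧ ∀ t ≤ T', S' t = S t) ∧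
        -- the final point is a competitive equilibrium
        I.IsCompetitiveEquilibrium (I.price P (S T).1) (I.allocation P (S T).1) ∧
        -- on each edge of the path: the edge is bounded, no point of it has `p_j = P` or
        -- `r_i = R`, and no point of it lies on a secondary ray
        ∀ t < T,
          (∀ k, (I.lcp P R ε).IsDoubleLabel (S t) k →
            (I.lcp P R ε).pivotEdge (S t)
              ((I.lcp P R ε).relaxed (AugLCP.previous S t) k) = segment ℝ (S t) (S (t + 1))) ∧
          ∀ x ∈ segment ℝ (S t) (S (t + 1)),
            (∀ j, x.1 (.p j) < P) ∧ (∀ i, x.1 (.r i) < R) ∧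
            ∀ E, (I.lcp P R ε).IsSecondaryRay E → x ∉ E := by
  obtain ⟨ρ₀, hρ₀⟩ := Market.exists_forall_linearIndependent hgen
  obtain ⟨B, hB⟩ := (Set.finite_range fun e : Σ i : N, Σ j : M, Fin (I.K i j + 1) =>
    P / -I.U e.1 e.2.1 e.2.2).bddAbove
  have hs := Market.maxSlope_pos hconn
  -- The four bounds give, in this order: generic rank at `R / P`, slack constraints for bads at `y
  -- = 0`, `R > 0`, and an initial `z` of at least `P (|M| + 1)`.
  refine ⟨max (max (ρ₀ * P) B) (max 0 (P * (Fintype.card M + 2) / sSup I.goodSlopes)),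
    fun R hR => ?_⟩
  simp only [max_lt_iff] at hR
  obtain ⟨⟨hRρ, hRB⟩, hR0, hRs⟩ := hR
  have hρ := hρ₀ (R / P) ((lt_div_iff₀ hP).2 hRρ)
  have hRbad : ∀ i j k, ¬ I.IsGood j → P < -I.U i j k * R := by
    intro i j k hj
    have h1 := Market.disutility_neg hI hj i k
    have h2 : P / -I.U i j k ≤ B := hB ⟨⟨i, j, k⟩, rfl⟩
    have h3 := (div_lt_iff₀ (neg_pos.2 h1)).1 (h2.trans_lt hRB)
    linarith
  have hRstart : P * (Fintype.card M + 1) ≤ I.startZ P R := by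
    rw [Market.startZ_eq]
    have := (div_lt_iff₀ hs).1 hRs
    linarith
  filter_upwards [ae_restrict_of_ae (I.ae_zCoeff_ne_zero (R / P)),
    ae_restrict_mem (MeasurableSet.univ_pi fun _ => measurableSet_Ioo)] with ε hε hmem
  have hεpos : ∀ j, 0 < ε j := fun j => (hmem j (Set.mem_univ j)).1
  have H := Market.regular hI hconn hP hR0 hεpos hRbad hRstart
    fun x hx hxΩ hz k k' hk hk' => Market.nondegenerate hI hgen hP hρ hε hx hxΩ hz hk hk'
  obtain ⟨T, S, hrun, hzT, hpath, huniq, hdet, hedge⟩ := H.exists_run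
  refine ⟨T, S, hrun, hzT, fun t ht => ⟨(hpath t ht).1, (hpath t ht).2.1⟩, huniq, hdet,
    Market.isCompetitiveEquilibrium hI (hpath T le_rfl).2.1 (hpath T le_rfl).2.2 hzT,
    fun t ht => ⟨(hedge t ht).1, fun x hx => ?_⟩⟩
  have hxΩ := ((hedge t ht).2 hx).1
  exact ⟨hxΩ.1, hxΩ.2, fun E hE => H.notMem_secondaryRay hxΩ hE⟩
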